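/- **Setting.** Let $(X,Y)\sim P$ be a task on $\mathcal X\times\mathcal Y$, let $f$ be a (possibly randomized) model with $f(X)\in\mathcal Y$, let $0\le \ell\le 1$ be a bounded loss, and put $R=\mathbb E\,\ell(f(X),Y)$. Let $D$ consist of $n$ i.i.d. points from $P$; the model is run on them independently, and evaluating point $i$ reveals $Z_i=\ell(f(X_i),Y_i)$. Let $A_1,\dots,A_K$ be a measurable partition (up to $P$-null sets) of $\mathcal X\times\mathcal Y$, with $\mu_k=P(A_k)$, $v_k=\operatorname{Var}(\ell(f(X),Y)\mid A_k)$, $\tilde D_k=D\cap A_k$ and $N_k=|\tilde D_k|$. The partition of $D$ is *benign* if $N_k/n\ge \ln(K+1)\max\{v_k,\epsilon^{2/3}\}$ for every $k$. An online evaluation algorithm, run with error level $\epsilon$ and failure probability $\delta$, is *$(n',\epsilon,\delta)$-certified* if the probability that it evaluates at least $n'$ points, or produces at least one confidence interval not containing $R$, is at most $\delta$. **Cer-Eval** with this partition first evaluates the first $m$ points of $D$, and then repeats the following round. Let $n_k$, $\hat R_k$, $\hat v_k$ be the number, the empirical mean and the empirical variance (normalized by $n_k$) of the losses evaluated so far in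 $\tilde D_k$, and let $$\eta_k=\sqrt{\frac{2\ln(\log_2 n_k+1)+\ln(16K/\delta)}{n_k}},\qquad \epsilon_k=\tfrac23\eta_k^2+2\sqrt{(\hat v_k+\eta_k+\eta_k^2)\,\eta_k^2},$$ with $\epsilon_k=\infty$ if $n_k=0$. The round produces the confidence interval $[\hat R-\hat\epsilon,\hat R+\hat\epsilon]$, where $\hat R=\sum_k\mu_k\hat R_k$ and $\hat\epsilon=\sum_k\mu_k\epsilon_k$ (no interval is produced while some $n_k=0$). The algorithm terminates if $\hat\epsilon\le\epsilon$ or if all of $D$ has been evaluated; otherwise it evaluates one more point of a group $k$ with $n_k<N_k$ that maximizes $\mu_k\,|\partial\epsilon_k/\partial n_k|$ (derivative with $\hat v_k$ held fixed; groups with $n_k=0$ come first). Ties between groups, and the choice of the unevaluated point in the group, are settled by arbitrary rules that do not see the data values. **Theorem.** There is a universal constant $c_0>0$ such that for all $c_2\ge c_1\ge c_0$ and $c_3\ge 0$ there is a constant $C>0$, depending only on $c_1,c_2,c_3$, with the following property. Let $0<\epsilon<1$, $0<\delta<1$, let $P,f,\ell$ and $A_1,\dots,A_K$ be as above, let $$c_1\,\epsilon^{-2}\{\ln(1/\delta)+\ln\ln(1/\epsilon)\}\le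 n\le c_2\,\epsilon^{-2}\{\ln(1/\delta)+\ln\ln(1/\epsilon)\},$$ and let $m\le c_3\,n\ln(K+1)\sum_{k=1}^K\max\{v_k,\epsilon^{2/3}\}$. Then there is $n'$ with $$\frac{n'}{n}\le C\,\ln(K+1)\sum_{k=1}^K\max\{v_k,\epsilon^{2/3}\}$$ such that, conditionally on any benign split of $D$ into $\tilde D_1,\dots,\tilde D_K$, Cer-Eval is $(n',\epsilon,\delta)$-certified. -/

import Mathlib

open MeasureTheory ProbabilityTheory

noncomputable section

namespace CerEval

/-! ### Online evaluation and certification -/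

/-- What a run of an online evaluation algorithm leaves behind: the number of test points whose
loss has been evaluated at termination, and all confidence intervals produced on the way, each
given as (centre, radius). -/
structure Outcome where
  numEvaluated : ℕ
  intervals : Set (ℝ × ℝ)

/-- The algorithm `alg`, run with error level `ε` and failure probability `δ` on data with law `Q`,
is `(n, ε, δ)`-certified for the true value `R`: the probability that it evaluates at least `n`
points, or produces at least one confidence interval that does not contain `R`, is at most `δ`. -/
def IsCertified {Ω : Type*} [MeasurableSpace Ω] (Q : Measure Ω) (R : ℝ)
    (alg : ℝ → ℝ → Ω → Outcome) (n : ℕ) (ε δ : ℝ) : Prop :=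
  Q {ω | n ≤ (alg ε δ ω).numEvaluated ∨
      ∃ I ∈ (alg ε δ ω).intervals, ¬ |R - I.1| ≤ I.2} ≤ ENNReal.ofReal δ

/-! ### The evaluation task -/

section Task

variable {𝒳 𝒴 : Type*} [MeasurableSpace 𝒳] [MeasurableSpace 𝒴]

/-- The joint law of `((X, Y), f(X))`, where `(X, Y)` has law `P` and `f` is a possibly
non-deterministic model, given `(X, Y)` randomised through the Markov kernel `f` from `X`. -/
def evalLaw (P : Measure (𝒳 × 𝒴)) (f : Kernel 𝒳 𝒴) : Measure ((𝒳 × 𝒴) × 𝒴) :=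
  P ⊗ₘ (f.prodMkRight 𝒴)

/-- The loss `ℓ(f(X), Y)` at `z = ((X, Y), f(X))`. -/
def lossAt (ℓ : 𝒴 → 𝒴 → ℝ) (z : (𝒳 × 𝒴) × 𝒴) : ℝ := ℓ z.2 z.1.2

/-- The prediction error `R = E ℓ(f(X), Y)`. -/
def risk (P : Measure (𝒳 × 𝒴)) (f : Kernel 𝒳 𝒴) (ℓ : 𝒴 → 𝒴 → ℝ) : ℝ :=
  ∫ z, lossAt ℓ z ∂(evalLaw P f)

/-- The variance of the loss `ℓ(f(X), Y)` conditioned on `(X, Y) ∈ A`. -/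
def condVar (P : Measure (𝒳 × 𝒴)) (f : Kernel 𝒳 𝒴) (ℓ : 𝒴 → 𝒴 → ℝ) (A : Set (𝒳 × 𝒴)) : ℝ :=
  variance (lossAt ℓ) ((evalLaw P f)[|Prod.fst ⁻¹' A])

open Classical in
/-- The parts of the dataset `D` cut out by `A`: the indices of the points of `D` in `A k`. -/
def groupsOf {n K : ℕ} (A : Fin K → Set (𝒳 × 𝒴)) (D : Fin n → 𝒳 × 𝒴) (k : Fin K) :
    Finset (Fin n) :=
  Finset.univ.filter fun i => D i ∈ A k

/-- The law of `n` IID test points, together with the (independent) outputs of the model on them,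
conditioned on the dataset being split by `A` into the parts `G`. -/
def dataLaw {n K : ℕ} (P : Measure (𝒳 × 𝒴)) (f : Kernel 𝒳 𝒴) (A : Fin K → Set (𝒳 × 𝒴))
    (G : Fin K → Finset (Fin n)) : Measure (Fin n → (𝒳 × 𝒴) × 𝒴) :=
  (Measure.pi fun _ : Fin n => evalLaw P f)[|{ω | groupsOf A (fun i => (ω i).1) = G}]

end Task

/-- The partition of a dataset of `n` points into the parts `G k` is benign, for the conditional
variances `v k` and the level `ε`. -/
def IsBenign {n K : ℕ} (v : Fin K → ℝ) (ε : ℝ) (G : Fin K → Finset (Fin n)) : Prop :=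
  ∀ k, Real.log (K + 1) * max (v k) (ε ^ (2 / 3 : ℝ)) ≤ ((G k).card : ℝ) / n

/-! ### The algorithm -/

/-- `η` after `t` evaluated points of a group, when there are `K` groups. -/
def eta (K : ℕ) (δ t : ℝ) : ℝ :=
  √((2 * Real.log (Real.logb 2 t + 1) + Real.log (16 * K / δ)) / t)

/-- The confidence radius of a group with empirical variance `v` and `t` evaluated points. -/
def radius (K : ℕ) (δ v t : ℝ) : ℝ :=
  2 * eta K δ t ^ 2 / 3 + 2 * √((v + eta K δ t + eta K δ t ^ 2) * eta K δ t ^ 2)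

/-- Empirical mean of the losses in `s`. -/
def empMean {n : ℕ} (Z : Fin n → ℝ) (s : Finset (Fin n)) : ℝ :=
  (∑ i ∈ s, Z i) / s.card

/-- Empirical variance of the losses in `s`. -/
def empVar {n : ℕ} (Z : Fin n → ℝ) (s : Finset (Fin n)) : ℝ :=
  (∑ i ∈ s, (Z i - empMean Z s) ^ 2) / s.card

/-- The inputs of the algorithm other than `ε`, `δ` and the losses. `pickGroup` breaks ties between
the groups that maximise the selection criterion, and `pickPoint` selects a point among the points
of the target group that have not been evaluated; neither of them sees the losses. -/
structure Input (n K : ℕ) where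
  /-- the number of warm start steps -/
  m : ℕ
  /-- the parts of the dataset -/
  group : Fin K → Finset (Fin n)
  /-- the weights (probability masses) of the groups -/
  weight : Fin K → ℝ
  pickGroup : Finset (Fin K) → Fin K
  pickPoint : Finset (Fin n) → Fin n

section Algorithm

variable {n K : ℕ} (a : Input n K) (ε δ : ℝ) (Z : Fin n → ℝ) (S : Finset (Fin n))

/-- The confidence radius of group `k`, when the points in `S` have been evaluated. -/
def groupRadius (k : Fin K) : ℝ :=
  radius K δ (empVar Z (S ∩ a.group k)) (S ∩ a.group k).card

/-- The performance estimate. -/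
def estimate : ℝ := ∑ k, a.weight k * empMean Z (S ∩ a.group k)

/-- The overall confidence radius. -/
def totalRadius : ℝ := ∑ k, a.weight k * groupRadius a δ Z S k

/-- Each group has an evaluated point. Before that, the radius is infinite: there is neither a
confidence interval nor a reason to stop. -/
def AllSampled : Prop := ∀ k, (S ∩ a.group k).Nonempty

/-- Termination: the radius is at most `ε`, or all points of the dataset have been evaluated. -/
def Stops : Prop := (AllSampled a S ∧ totalRadius a δ Z S ≤ ε) ∨ S = Finset.univ

/-- The selection criterion `|∂ε_k/∂n_k| * (weight of group k)`: the rate at which one more point of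
group `k` lowers the overall radius. -/
def score (k : Fin K) : ℝ :=
  -(deriv (fun t => radius K δ (empVar Z (S ∩ a.group k)) t) (S ∩ a.group k).card) * a.weight k

open Classical in
/-- The groups that still have points to evaluate. -/
def openGroups : Finset (Fin K) := Finset.univ.filter fun k => ¬ a.group k ⊆ S

open Classical in
/-- The open groups without any evaluated point; their radius is infinite. -/
def unseenGroups : Finset (Fin K) := (openGroups a S).filter fun k => S ∩ a.group k = ∅

open Classical in
/-- The candidates for the target group: the maximisers of the selection criterion among the open
groups, where the groups without any evaluated point come first. -/
def targets : Finset (Fin K) :=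
  if (unseenGroups a S).Nonempty then unseenGroups a S
  else (openGroups a S).filter fun k => ∀ j ∈ openGroups a S, score a δ Z S j ≤ score a δ Z S k

open Classical in
/-- One round of the main loop, on the set of evaluated points. -/
def step : Finset (Fin n) :=
  if Stops a ε δ Z S then S
  else insert (a.pickPoint (a.group (a.pickGroup (targets a δ Z S)) \ S)) S

/-- The set of evaluated points after the warm start and `t` rounds: the first `m` points of the
dataset, and the points chosen since then. -/
def evaluated (t : ℕ) : Finset (Fin n) :=
  (step a ε δ Z)^[t] (Finset.univ.filter fun i : Fin n => (i : ℕ) < a.m)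

/-- The run of the algorithm on the losses `Z`. Each round that does not stop evaluates a new
point, so `n` rounds suffice for termination. -/
def run : Outcome where
  numEvaluated := (evaluated a ε δ Z n).card
  intervals := {I | ∃ t, AllSampled a (evaluated a ε δ Z t) ∧
    I = (estimate a Z (evaluated a ε δ Z t), totalRadius a δ Z (evaluated a ε δ Z t))}

end Algorithm

/-- Cer-Eval with the partition `A` of the task distribution `P` as its partition subroutine, as a
function of the error level, the failure probability, and the dataset with the outputs of the
model on it. The weight of a group is its mass `P (A k)`, which is known (for a dataset that
represents `P`, this is the proportion of its points in group `k`). -/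
def cerEval {𝒳 𝒴 : Type*} [MeasurableSpace 𝒳] [MeasurableSpace 𝒴] {n K : ℕ}
    (P : Measure (𝒳 × 𝒴)) (ℓ : 𝒴 → 𝒴 → ℝ) (A : Fin K → Set (𝒳 × 𝒴)) (m : ℕ)
    (pickGroup : Finset (Fin K) → Fin K) (pickPoint : Finset (Fin n) → Fin n)
    (ε δ : ℝ) (ω : Fin n → (𝒳 × 𝒴) × 𝒴) : Outcome :=
  run
    { m := m
      group := groupsOf A fun i => (ω i).1
      weight := fun k => P.real (A k)
      pickGroup := pickGroup
      pickPoint := pickPoint }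
    ε δ fun i => lossAt ℓ (ω i)

end CerEval

end

/-! Conditionally on the split, the losses are independent, and those of group `k` have the mean and
variance of the loss given `A k` (`dataLaw_spec`). The losses influence how many points of a group
are evaluated, never their order, so the evaluated part of a group is always a member of a chain of
index sets fixed in advance (`evaluated_inter_group`). It therefore suffices to control empirical
means and variances uniformly along each chain.

Validity: maximal Hoeffding and Bernstein inequalities on dyadic blocks of sample sizes show that,
outside an event of probability `δ / K` per group, every empirical mean is within its radius and
every empirical variance is at most `v k + η` (`measure_exists_not_isAccurate_le`). Averaging over
the groups with their weights gives the coverage of `R`.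

Efficiency is deterministic outside these events (`card_evaluated_le`). Write `h k` for `n * log (K
+ 1) * max (v k) (ε ^ (2/3))`. After a large multiple of `h k` points the radius of group `k` is a
small multiple of `ε` (`radius_le_of_le_card`), and the derivative of a radius is comparable to
radius / sample size (`score_le_div`, `div_le_score`). If far more than `∑ h k` points were
evaluated, most of them would lie in groups far beyond `h k`. Look at each such group when it was
last selected, and take the one, `k₀`, whose score `σ` was then least. On one hand `σ` times the
total size of these groups is a small multiple of `ε`. On the other hand, when `k₀` was selected,
`σ` dominated the scores of all open groups, so the weighted radius of each was at most `16 σ` times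
its size, unless it was small anyway; exhausted groups have small radii because the split is benign.
Hence the total radius was already at most `ε`, and the algorithm would have stopped.

If `ε` is not small, the claimed bound exceeds `n` and there is nothing to prove about the sample
size. -/

namespace CerEval

/-! ### Maximal inequalities along chains of index sets -/

section Maximal

variable {Ω ι : Type*} [MeasurableSpace Ω] {μ : Measure Ω}
  {X : ι → Ω → ℝ}

/-- For independent variables, an integral over an event determined by the variables in `S` of a
product of a function of these and of a function of the variables in a disjoint `T`. -/
lemma lintegral_mul_of_disjoint (hX : iIndepFun X μ) (hm : ∀ i, Measurable (X i))
    {S T : Finset ι} (hST : Disjoint S T) {φ : (S → ℝ) → ENNReal} {ψ : (T → ℝ) → ENNReal}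
    (hφ : Measurable φ) (hψ : Measurable ψ) :
    ∫⁻ ω, φ (fun i => X i ω) * ψ (fun i => X i ω) ∂μ =
      (∫⁻ ω, φ (fun i => X i ω) ∂μ) * ∫⁻ ω, ψ (fun i => X i ω) ∂μ := by
  have h := (hX.indepFun_finset S T hST hm).comp hφ hψ
  exact lintegral_mul_eq_lintegral_mul_lintegral_of_indepFun
    (hφ.comp (measurable_pi_lambda _ fun i => hm i))
    (hψ.comp (measurable_pi_lambda _ fun i => hm i)) h

lemma lintegral_exp_sum (hX : iIndepFun X μ) (hm : ∀ i, Measurable (X i)) (s : ℝ)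
    (S : Finset ι) :
    ∫⁻ ω, ENNReal.ofReal (Real.exp (s * ∑ i ∈ S, X i ω)) ∂μ =
      ∏ i ∈ S, ∫⁻ ω, ENNReal.ofReal (Real.exp (s * X i ω)) ∂μ := by
  have hg : Measurable fun x : ℝ => ENNReal.ofReal (Real.exp (s * x)) := by fun_prop
  have := lintegral_prod_eq_prod_lintegral_of_indepFun S
    (fun i ω => ENNReal.ofReal (Real.exp (s * X i ω)))
    (hX.comp (fun _ x => ENNReal.ofReal (Real.exp (s * x))) fun _ => hg) fun i => hg.comp (hm i)
  rw [← this]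
  refine lintegral_congr fun ω => ?_
  rw [Finset.mul_sum, Real.exp_sum, ENNReal.ofReal_prod_of_nonneg fun _ _ => (Real.exp_pos _).le]

/-- The first-passage step of Doob's argument. Whether the level `x` is first reached at `T j` is
decided by the variables in `T j`; the exponential over `T J \ T j` is an independent factor with
mean at least one, so inserting it can only increase the integral. -/
lemma exp_mul_measure_disjointed_le (hX : iIndepFun X μ) (hm : ∀ i, Measurable (X i))
    {s x : ℝ} (hs : 0 ≤ s) {T : ℕ → Finset ι} (hT : Monotone T) {j J : ℕ} (hj : j ≤ J)
    (hone : ∀ i ∈ T J, 1 ≤ ∫⁻ ω, ENNReal.ofReal (Real.exp (s * X i ω)) ∂μ) :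
    ENNReal.ofReal (Real.exp (s * x)) *
        μ (disjointed (fun l => {ω | x ≤ ∑ i ∈ T l, X i ω}) j) ≤
      ∫⁻ ω in disjointed (fun l => {ω | x ≤ ∑ i ∈ T l, X i ω}) j,
        ENNReal.ofReal (Real.exp (s * ∑ i ∈ T J, X i ω)) ∂μ := by
  classical
  set E : ℕ → Set Ω := fun l => {ω | x ≤ ∑ i ∈ T l, X i ω} with hE
  have hEm : ∀ l, MeasurableSet (E l) := fun l =>
    measurableSet_le measurable_const (Finset.measurable_fun_sum _ fun i _ => hm i)
  have hDm : MeasurableSet (disjointed E j) := MeasurableSet.disjointed hEm j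
  -- The crossing events as sets of vectors indexed by `T j`, which exhibits first passage at `j` as
  -- a function of these coordinates alone.
  let F : ℕ → Set (T j → ℝ) := fun l =>
    {y | x ≤ ∑ i : T j, if (i : ι) ∈ T l then y i else 0}
  have hFm : ∀ l, MeasurableSet (F l) := fun l =>
    measurableSet_le measurable_const (Finset.measurable_fun_sum _ fun i _ => by
      split_ifs
      · exact measurable_pi_apply i
      · exact measurable_const)
  have hsum : ∀ l ≤ j, ∀ ω, ∑ i ∈ T l, X i ω = ∑ i : T j, if (i : ι) ∈ T l then X i ω else 0 := by
    intro l hl ω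
    rw [Finset.sum_coe_sort (T j) (fun i => if i ∈ T l then X i ω else 0), ← Finset.sum_filter,
      Finset.filter_mem_eq_inter, Finset.inter_eq_right.2 (hT hl)]
  have hFD : ∀ ω, ω ∈ disjointed E j ↔ (fun i : T j => X i ω) ∈ disjointed F j := by
    intro ω
    have key : ∀ l ≤ j, (ω ∈ E l ↔ (fun i : T j => X i ω) ∈ F l) := by
      intro l hl
      simp only [hE, F, Set.mem_ofPred_eq]
      rw [hsum l hl ω]
    rw [disjointed_apply, disjointed_apply]
    simp only [Set.mem_sdiff, Finset.sup_set_eq_biUnion, Set.mem_iUnion, not_exists,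
      Finset.mem_Iio]
    rw [key j le_rfl]
    refine and_congr_right fun _ => forall_congr' fun l => ?_
    constructor
    · intro h hl h2; exact h hl ((key l hl.le).2 h2)
    · intro h hl h2; exact h hl ((key l hl.le).1 h2)
  let φ : (T j → ℝ) → ENNReal :=
    (disjointed F j).indicator fun y => ENNReal.ofReal (Real.exp (s * ∑ i, y i))
  have hφ : Measurable φ :=
    Measurable.indicator (by fun_prop) (MeasurableSet.disjointed hFm j)
  let ψ : ((T J \ T j : Finset ι) → ℝ) → ENNReal := fun y => ENNReal.ofReal (Real.exp (s * ∑ i, y i))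
  have hψ : Measurable ψ := by fun_prop
  have h1 : ∀ ω, (disjointed E j).indicator
      (fun ω => ENNReal.ofReal (Real.exp (s * ∑ i ∈ T j, X i ω))) ω = φ (fun i => X i ω) := by
    intro ω
    simp only [φ, Set.indicator, hFD ω]
    rw [Finset.sum_coe_sort (T j) (fun i => X i ω)]
  have h2 : ∀ ω, ψ (fun i => X i ω) =
      ENNReal.ofReal (Real.exp (s * ∑ i ∈ T J \ T j, X i ω)) := by
    intro ω
    simp only [ψ]
    rw [Finset.sum_coe_sort (T J \ T j) (fun i => X i ω)]
  have h3 : ∀ ω, (disjointed E j).indicator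
      (fun ω => ENNReal.ofReal (Real.exp (s * ∑ i ∈ T J, X i ω))) ω =
        φ (fun i => X i ω) * ψ (fun i => X i ω) := by
    intro ω
    rw [← h1, h2]
    by_cases hω : ω ∈ disjointed E j
    · simp only [Set.indicator_of_mem hω]
      rw [← ENNReal.ofReal_mul (Real.exp_pos _).le, ← Real.exp_add, ← mul_add, add_comm,
        Finset.sum_sdiff (hT hj)]
    · simp [Set.indicator_of_notMem hω]
  have h4 : 1 ≤ ∫⁻ ω, ψ (fun i => X i ω) ∂μ := by
    simp_rw [h2]
    rw [lintegral_exp_sum hX hm]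
    exact Finset.one_le_prod' fun i hi => hone i (Finset.mem_sdiff.1 hi).1
  calc ENNReal.ofReal (Real.exp (s * x)) * μ (disjointed E j)
      = ∫⁻ _ in disjointed E j, ENNReal.ofReal (Real.exp (s * x)) ∂μ := by simp
    _ ≤ ∫⁻ ω in disjointed E j, ENNReal.ofReal (Real.exp (s * ∑ i ∈ T j, X i ω)) ∂μ := by
        refine setLIntegral_mono' hDm fun ω hω => ?_
        have : ω ∈ E j := disjointed_subset E j hω
        exact ENNReal.ofReal_le_ofReal
          (Real.exp_le_exp.2 (mul_le_mul_of_nonneg_left this hs))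
    _ = ∫⁻ ω, φ (fun i => X i ω) ∂μ := by
        rw [← lintegral_indicator hDm]; exact lintegral_congr h1
    _ ≤ (∫⁻ ω, φ (fun i => X i ω) ∂μ) * ∫⁻ ω, ψ (fun i => X i ω) ∂μ :=
        le_mul_of_one_le_right' h4
    _ = ∫⁻ ω, φ (fun i => X i ω) * ψ (fun i => X i ω) ∂μ :=
        (lintegral_mul_of_disjoint hX hm Finset.disjoint_sdiff hφ hψ).symm
    _ = _ := by
        rw [← lintegral_indicator hDm]; exact (lintegral_congr h3).symm

/-- Doob's maximal inequality for the exponential of the partial sums of independent variables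
along a chain of index sets. -/
lemma measure_exists_le_sum_le (hX : iIndepFun X μ) (hm : ∀ i, Measurable (X i))
    {s : ℝ} (x : ℝ) (hs : 0 ≤ s) {T : ℕ → Finset ι} (hT : Monotone T) (J : ℕ)
    (hone : ∀ i ∈ T J, 1 ≤ ∫⁻ ω, ENNReal.ofReal (Real.exp (s * X i ω)) ∂μ) :
    ENNReal.ofReal (Real.exp (s * x)) * μ {ω | ∃ j ≤ J, x ≤ ∑ i ∈ T j, X i ω} ≤
      ∏ i ∈ T J, ∫⁻ ω, ENNReal.ofReal (Real.exp (s * X i ω)) ∂μ := by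
  set E : ℕ → Set Ω := fun l => {ω | x ≤ ∑ i ∈ T l, X i ω} with hE
  have hEm : ∀ l, MeasurableSet (E l) := fun l =>
    measurableSet_le measurable_const (Finset.measurable_fun_sum _ fun i _ => hm i)
  have hDm : ∀ j, MeasurableSet (disjointed E j) := MeasurableSet.disjointed hEm
  have hU : {ω | ∃ j ≤ J, x ≤ ∑ i ∈ T j, X i ω} ⊆ ⋃ j ∈ Finset.range (J + 1), disjointed E j := by
    rintro ω ⟨j, hj, hω⟩
    have : ω ∈ partialSups E J := by
      rw [partialSups_eq_biUnion_range]
      simp only [Set.mem_iUnion]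
      exact ⟨j, Finset.mem_range.2 (by omega), hω⟩
    rwa [← partialSups_disjointed, partialSups_eq_biUnion_range] at this
  calc _ ≤ ENNReal.ofReal (Real.exp (s * x)) * ∑ j ∈ Finset.range (J + 1), μ (disjointed E j) := by
        gcongr
        exact (measure_mono hU).trans (measure_biUnion_finset_le _ _)
    _ = ∑ j ∈ Finset.range (J + 1),
          ENNReal.ofReal (Real.exp (s * x)) * μ (disjointed E j) := by rw [Finset.mul_sum]
    _ ≤ ∑ j ∈ Finset.range (J + 1), ∫⁻ ω in disjointed E j,
          ENNReal.ofReal (Real.exp (s * ∑ i ∈ T J, X i ω)) ∂μ := by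
        refine Finset.sum_le_sum fun j hj => ?_
        exact exp_mul_measure_disjointed_le hX hm hs hT
          (Nat.lt_succ_iff.1 (Finset.mem_range.1 hj)) hone
    _ = ∫⁻ ω in ⋃ j ∈ Finset.range (J + 1), disjointed E j,
          ENNReal.ofReal (Real.exp (s * ∑ i ∈ T J, X i ω)) ∂μ := by
        rw [lintegral_biUnion_finset ((disjoint_disjointed E).set_pairwise _) fun j _ => hDm j]
    _ ≤ ∫⁻ ω, ENNReal.ofReal (Real.exp (s * ∑ i ∈ T J, X i ω)) ∂μ := setLIntegral_le_lintegral _ _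
    _ = _ := lintegral_exp_sum hX hm s _

/-- The maximal Chernoff bound along the members with at most `M` elements of a chain of subsets of
`G`. -/
lemma measure_exists_card_le (hX : iIndepFun X μ) (hm : ∀ i, Measurable (X i))
    {s : ℝ} (x : ℝ) (hs : 0 ≤ s) {T : ℕ → Finset ι} (hT : Monotone T) {G : Finset ι}
    (hG : ∀ j, T j ⊆ G) {ψ : ℝ} (hψ : 0 ≤ ψ) {M : ℕ}
    (hone : ∀ i ∈ G, 1 ≤ ∫⁻ ω, ENNReal.ofReal (Real.exp (s * X i ω)) ∂μ)
    (hle : ∀ i ∈ G, ∫⁻ ω, ENNReal.ofReal (Real.exp (s * X i ω)) ∂μ ≤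
      ENNReal.ofReal (Real.exp ψ)) :
    μ {ω | ∃ j, (T j).card ≤ M ∧ x ≤ ∑ i ∈ T j, X i ω} ≤
      ENNReal.ofReal (Real.exp (M * ψ - s * x)) := by
  have main : ∀ J, (T J).card ≤ M → μ {ω | ∃ j ≤ J, x ≤ ∑ i ∈ T j, X i ω} ≤
      ENNReal.ofReal (Real.exp (M * ψ - s * x)) := by
    intro J hJ
    have h := measure_exists_le_sum_le hX hm x hs hT J fun i hi => hone i (hG J hi)
    have h2 : ∏ i ∈ T J, ∫⁻ ω, ENNReal.ofReal (Real.exp (s * X i ω)) ∂μ ≤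
        ENNReal.ofReal (Real.exp (M * ψ)) := by
      calc _ ≤ ∏ _i ∈ T J, ENNReal.ofReal (Real.exp ψ) :=
            Finset.prod_le_prod' fun i hi => hle i (hG J hi)
        _ = ENNReal.ofReal (Real.exp ((T J).card * ψ)) := by
            rw [Finset.prod_const, ← ENNReal.ofReal_pow (Real.exp_pos _).le, ← Real.exp_nat_mul]
        _ ≤ _ := by gcongr
    rw [sub_eq_add_neg, Real.exp_add, ENNReal.ofReal_mul (Real.exp_pos _).le, Real.exp_neg,
      ENNReal.ofReal_inv_of_pos (Real.exp_pos _), ← div_eq_mul_inv,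
      ENNReal.le_div_iff_mul_le (by simp [Real.exp_pos]) (by simp), mul_comm]
    exact h.trans h2
  -- If the cap `M` is never exceeded, no last admissible index is at hand, and the bound is passed
  -- to the increasing union over `J`. Otherwise `Nat.findGreatest` supplies the last one.
  by_cases hall : ∀ j, (T j).card ≤ M
  · have hmono : Monotone fun J => {ω | ∃ j ≤ J, x ≤ ∑ i ∈ T j, X i ω} := by
      rintro J J' hJ ω ⟨j, hj, h⟩
      exact ⟨j, hj.trans hJ, h⟩
    have hU : {ω | ∃ j, (T j).card ≤ M ∧ x ≤ ∑ i ∈ T j, X i ω} ⊆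
        ⋃ J, {ω | ∃ j ≤ J, x ≤ ∑ i ∈ T j, X i ω} := by
      rintro ω ⟨j, -, h⟩
      exact Set.mem_iUnion.2 ⟨j, j, le_rfl, h⟩
    refine (measure_mono hU).trans ?_
    rw [hmono.measure_iUnion]
    exact iSup_le fun J => main J (hall J)
  · push Not at hall
    obtain ⟨J', hJ'⟩ := hall
    by_cases h0 : (T 0).card ≤ M
    · have hlt : ∀ j, (T j).card ≤ M → j ≤ Nat.findGreatest (fun j => (T j).card ≤ M) J' := by
        intro j hj
        refine Nat.le_findGreatest ?_ hj
        by_contra hc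
        exact absurd (hj.trans_lt hJ') (not_lt.2 (Finset.card_le_card (hT (not_le.1 hc).le)))
      refine (measure_mono ?_).trans (main _
        (Nat.findGreatest_spec (P := fun j => (T j).card ≤ M) (Nat.zero_le J') h0))
      rintro ω ⟨j, hj, h⟩
      exact ⟨j, hlt j hj, h⟩
    · have : {ω | ∃ j, (T j).card ≤ M ∧ x ≤ ∑ i ∈ T j, X i ω} = ∅ := by
        ext ω
        simp only [Set.mem_ofPred_eq, Set.mem_empty_iff_false, iff_false]
        rintro ⟨j, hj, -⟩
        exact h0 ((Finset.card_le_card (hT (Nat.zero_le j))).trans hj)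
      simp [this]

end Maximal

/-! ### Maximal Hoeffding and Bernstein bounds -/

section Tails

variable {Ω ι : Type*} [MeasurableSpace Ω] {μ : Measure Ω} [IsProbabilityMeasure μ]

lemma integrable_of_mem_Icc {X : Ω → ℝ} (hm : Measurable X) {a b : ℝ}
    (hb : ∀ ω, X ω ∈ Set.Icc a b) : Integrable X μ :=
  Integrable.of_mem_Icc a b hm.aemeasurable (ae_of_all _ hb)

lemma integrable_exp_mul_of_forall_mem_Icc {X : Ω → ℝ} (hm : Measurable X) {a b : ℝ}
    (hb : ∀ ω, X ω ∈ Set.Icc a b) (s : ℝ) : Integrable (fun ω => Real.exp (s * X ω)) μ :=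
  integrable_exp_mul_of_mem_Icc hm.aemeasurable (ae_of_all _ hb)

lemma lintegral_exp_eq {X : Ω → ℝ} (hm : Measurable X) {a b : ℝ}
    (hb : ∀ ω, X ω ∈ Set.Icc a b) (s : ℝ) :
    ∫⁻ ω, ENNReal.ofReal (Real.exp (s * X ω)) ∂μ = ENNReal.ofReal (∫ ω, Real.exp (s * X ω) ∂μ) :=
  (ofReal_integral_eq_lintegral_ofReal (integrable_exp_mul_of_forall_mem_Icc hm hb s)
    (ae_of_all _ fun _ => (Real.exp_pos _).le)).symm

/-- The submartingale input of the maximal inequality, from `1 + y ≤ exp y`. -/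
lemma one_le_lintegral_exp {X : Ω → ℝ} (hm : Measurable X) {a b : ℝ}
    (hb : ∀ ω, X ω ∈ Set.Icc a b) (h0 : ∫ ω, X ω ∂μ = 0) (s : ℝ) :
    1 ≤ ∫⁻ ω, ENNReal.ofReal (Real.exp (s * X ω)) ∂μ := by
  rw [lintegral_exp_eq hm hb, ENNReal.one_le_ofReal]
  have hi := integrable_of_mem_Icc (μ := μ) hm hb
  calc (1 : ℝ) = ∫ ω, (s * X ω + 1) ∂μ := by
        rw [integral_add (hi.const_mul s) (integrable_const _), integral_const_mul, h0]; simp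
    _ ≤ _ := integral_mono ((hi.const_mul s).add (integrable_const _))
        (integrable_exp_mul_of_forall_mem_Icc hm hb s) fun ω => Real.add_one_le_exp _

/-- The maximal version of Hoeffding's inequality. -/
lemma measure_exists_hoeffding_le {X : ι → Ω → ℝ} (hX : iIndepFun X μ)
    (hm : ∀ i, Measurable (X i)) {a : ℝ} (hb : ∀ i ω, X i ω ∈ Set.Icc a (a + 1))
    {T : ℕ → Finset ι} (hT : Monotone T) {G : Finset ι} (hG : ∀ j, T j ⊆ G)
    (h0 : ∀ i ∈ G, ∫ ω, X i ω ∂μ = 0) {M : ℕ} (hM : 0 < M) {l : ℝ} (hl : 0 ≤ l) :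
    μ {ω | ∃ j, (T j).card ≤ M ∧ √(M * l / 2) ≤ ∑ i ∈ T j, X i ω} ≤
      ENNReal.ofReal (Real.exp (-l)) := by
  have hM' : (0 : ℝ) < M := by exact_mod_cast hM
  set x := √(M * l / 2) with hx
  have hx2 : x ^ 2 = M * l / 2 := Real.sq_sqrt (by positivity)
  -- `s = 4 x / M` minimises `M s ^ 2 / 8 - s x`; the minimum is `-2 x ^ 2 / M = -l`.
  have h := measure_exists_card_le hX hm (s := 4 * x / M) x (by positivity) hT hG
    (ψ := (4 * x / M) ^ 2 / 8) (by positivity) (M := M)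
    (fun i hi => one_le_lintegral_exp (hm i) (hb i) (h0 i hi) _) (by
      intro i hi
      rw [lintegral_exp_eq (hm i) (hb i)]
      refine ENNReal.ofReal_le_ofReal ?_
      have := (hasSubgaussianMGF_of_mem_Icc_of_integral_eq_zero (hm i).aemeasurable
        (ae_of_all _ (hb i)) (h0 i hi)).mgf_le (4 * x / M)
      refine this.trans (Real.exp_le_exp.2 (le_of_eq ?_))
      simp
      ring)
  convert h using 3
  field_simp
  rw [hx2]
  ring

lemma exp_le_of_nonpos {y : ℝ} (hy : y ≤ 0) : Real.exp y ≤ 1 + y + y ^ 2 / 2 := by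
  have hd : ∀ x : ℝ, HasDerivAt (fun y : ℝ => 1 + y + y ^ 2 / 2 - Real.exp y)
      (1 + x - Real.exp x) x := by
    intro x
    have := ((((hasDerivAt_id x).const_add 1).add (((hasDerivAt_id x).pow 2).div_const 2))).sub
      (Real.hasDerivAt_exp x)
    exact this.congr_deriv (by simp)
  have hanti : Antitone (fun y : ℝ => 1 + y + y ^ 2 / 2 - Real.exp y) := by
    refine antitone_of_deriv_nonpos (fun x => (hd x).differentiableAt) fun x => ?_
    rw [(hd x).deriv]
    linarith [Real.add_one_le_exp x]
  have := hanti hy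
  simp at this
  linarith

/-- The Padé bound of type (2, 1) for `exp`; divided by `1 - y / 3` its right side equals `1 + y + y
^ 2 / (2 * (1 - y / 3))`, the Bernstein form. -/
lemma exp_mul_le_of_nonneg {y : ℝ} (hy : 0 ≤ y) :
    Real.exp y * (1 - y / 3) ≤ 1 + 2 * y / 3 + y ^ 2 / 6 := by
  have hd : ∀ x : ℝ, HasDerivAt
      (fun y : ℝ => (1 + 2 * y / 3 + y ^ 2 / 6) * Real.exp (-y) - (1 - y / 3))
      (1 / 3 - (1 + x + x ^ 2 / 2) / 3 * Real.exp (-x)) x := by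
    intro x
    have := (((((hasDerivAt_id x).const_mul 2).div_const 3).const_add 1).add
      (((hasDerivAt_id x).pow 2).div_const 6)).mul (hasDerivAt_id x).neg.exp
    have := this.sub (((hasDerivAt_id x).div_const 3).const_sub 1)
    exact this.congr_deriv (by simp; ring)
  have hmono : MonotoneOn
      (fun y : ℝ => (1 + 2 * y / 3 + y ^ 2 / 6) * Real.exp (-y) - (1 - y / 3)) (Set.Ici 0) := by
    refine monotoneOn_of_deriv_nonneg (convex_Ici 0)
      (fun x _ => (hd x).continuousAt.continuousWithinAt)
      (fun x _ => (hd x).differentiableAt.differentiableWithinAt) fun x hx => ?_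
    rw [interior_Ici] at hx
    rw [(hd x).deriv]
    have h1 := Real.quadratic_le_exp_of_nonneg (le_of_lt hx)
    have h2 : (1 + x + x ^ 2 / 2) * Real.exp (-x) ≤ 1 := by
      rw [Real.exp_neg, ← div_eq_mul_inv, div_le_one (Real.exp_pos x)]
      exact h1
    linarith
  have := hmono (Set.mem_Ici.2 le_rfl) (Set.mem_Ici.2 hy) hy
  simp only [neg_zero, Real.exp_zero, mul_zero, zero_div, add_zero, mul_one, ne_eq,
    OfNat.ofNat_ne_zero, not_false_eq_true, zero_pow, sub_zero, sub_self, sub_nonneg] at this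
  have h3 : (1 - y / 3) * Real.exp y ≤
      ((1 + 2 * y / 3 + y ^ 2 / 6) * Real.exp (-y)) * Real.exp y :=
    mul_le_mul_of_nonneg_right this (Real.exp_pos y).le
  rw [mul_assoc, ← Real.exp_add] at h3
  simp at h3
  linarith

lemma exp_le_bernstein {y s : ℝ} (hy : y ≤ s) (hs0 : 0 ≤ s) (hs : s < 3) :
    Real.exp y ≤ 1 + y + y ^ 2 / (2 * (1 - s / 3)) := by
  rcases le_total y 0 with h | h
  · refine (exp_le_of_nonpos h).trans ?_
    gcongr
    · linarith
    · linarith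
  · have h1 := exp_mul_le_of_nonneg h
    have h2 : Real.exp y ≤ 1 + y + y ^ 2 / (2 * (1 - y / 3)) := by
      have h3 : 0 < 1 - y / 3 := by linarith
      have h4 : Real.exp y ≤ (1 + 2 * y / 3 + y ^ 2 / 6) / (1 - y / 3) := by
        rwa [le_div_iff₀ h3]
      refine h4.trans (le_of_eq ?_)
      rw [div_eq_iff h3.ne', add_mul, div_mul_eq_mul_div, mul_div_mul_right _ _ h3.ne']
      ring
    refine h2.trans ?_
    have : 0 < 1 - s / 3 := by linarith
    gcongr

lemma integral_exp_le_bernstein {X : Ω → ℝ} (hm : Measurable X)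
    (hb : ∀ ω, X ω ∈ Set.Icc (-1) 1) (h0 : ∫ ω, X ω ∂μ = 0) {v s : ℝ}
    (hv : ∫ ω, X ω ^ 2 ∂μ = v) (hs0 : 0 ≤ s) (hs : s < 3) :
    ∫ ω, Real.exp (s * X ω) ∂μ ≤ Real.exp (v * s ^ 2 / (2 * (1 - s / 3))) := by
  have hi := integrable_of_mem_Icc (μ := μ) hm hb
  have hi2 : Integrable (fun ω => X ω ^ 2) μ :=
    integrable_of_mem_Icc (hm.pow_const 2) (a := 0) (b := 1) fun ω =>
      ⟨sq_nonneg _, by have := hb ω; nlinarith [this.1, this.2]⟩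
  calc ∫ ω, Real.exp (s * X ω) ∂μ
      ≤ ∫ ω, ((1 + s * X ω) + s ^ 2 / (2 * (1 - s / 3)) * X ω ^ 2) ∂μ := by
        refine integral_mono (integrable_exp_mul_of_forall_mem_Icc hm hb s)
          (((integrable_const _).add (hi.const_mul s)).add (hi2.const_mul _)) fun ω => ?_
        have := exp_le_bernstein (y := s * X ω) (s := s)
          (by nlinarith [(hb ω).2]) hs0 hs
        refine this.trans (le_of_eq ?_)
        ring
    _ = v * s ^ 2 / (2 * (1 - s / 3)) + 1 := by
        rw [integral_add (f := fun ω => 1 + s * X ω) ((integrable_const _).add (hi.const_mul s))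
            (hi2.const_mul _),
          integral_add (integrable_const _) (hi.const_mul s), integral_const_mul,
          integral_const_mul, h0, hv]
        simp
        ring
    _ ≤ _ := Real.add_one_le_exp _

/-- The maximal version of Bernstein's inequality. -/
lemma measure_exists_bernstein_le {X : ι → Ω → ℝ} (hX : iIndepFun X μ)
    (hm : ∀ i, Measurable (X i)) (hb : ∀ i ω, X i ω ∈ Set.Icc (-1) 1)
    {T : ℕ → Finset ι} (hT : Monotone T) {G : Finset ι} (hG : ∀ j, T j ⊆ G)
    (h0 : ∀ i ∈ G, ∫ ω, X i ω ∂μ = 0) {v : ℝ} (hv0 : 0 ≤ v)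
    (hv : ∀ i ∈ G, ∫ ω, X i ω ^ 2 ∂μ = v) (M : ℕ) {l : ℝ} (hl : 0 < l) :
    μ {ω | ∃ j, (T j).card ≤ M ∧ √(2 * M * v * l) + 2 * l / 3 ≤ ∑ i ∈ T j, X i ω} ≤
      ENNReal.ofReal (Real.exp (-l)) := by
  set w := √(2 * M * v * l) with hw
  have hw0 : 0 ≤ w := Real.sqrt_nonneg _
  have hw2 : w ^ 2 = 2 * M * v * l := Real.sq_sqrt (by positivity)
  have hden : 0 < w + 4 * l / 3 := by positivity
  -- Not the exact optimiser: this choice makes `1 - s / 3` the quotient of the threshold `w + 2 l /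
  -- 3` by `w + 4 l / 3`, so that everything has one denominator. The final comparison then has a
  -- slack proportional to `w * l ^ 2`.
  set s := 2 * l / (w + 4 * l / 3) with hs
  have hs0 : 0 ≤ s := by positivity
  have hs1 : 1 - s / 3 = (w + 2 * l / 3) / (w + 4 * l / 3) := by
    rw [hs]; field_simp; ring
  have hs2 : 0 < 1 - s / 3 := by rw [hs1]; positivity
  have hs3 : s < 3 := by linarith
  have h := measure_exists_card_le hX hm (s := s) (w + 2 * l / 3) hs0 hT hG
    (ψ := v * s ^ 2 / (2 * (1 - s / 3))) (by positivity) (M := M)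
    (fun i hi => one_le_lintegral_exp (hm i) (hb i) (h0 i hi) _) (by
      intro i hi
      rw [lintegral_exp_eq (hm i) (hb i)]
      exact ENNReal.ofReal_le_ofReal
        (integral_exp_le_bernstein (hm i) (hb i) (h0 i hi) (hv i hi) hs0 hs3))
  refine h.trans (ENNReal.ofReal_le_ofReal (Real.exp_le_exp.2 ?_))
  have e1 : M * (v * s ^ 2 / (2 * (1 - s / 3))) =
      l * w ^ 2 / ((w + 4 * l / 3) * (w + 2 * l / 3)) := by
    rw [hs1, hw2, hs]
    field_simp
  have e2 : s * (w + 2 * l / 3) =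
      l * (2 * (w + 2 * l / 3) ^ 2) / ((w + 4 * l / 3) * (w + 2 * l / 3)) := by
    rw [hs]
    field_simp
  rw [e1, e2, ← sub_div, div_le_iff₀ (by positivity)]
  nlinarith [mul_nonneg hl.le (mul_nonneg hw0 hl.le)]

end Tails

/-! ### From deviation bounds to the empirical confidence radius -/

/-- The logarithmic factor in the numerator of `eta ^ 2`. -/
noncomputable def logFactor (K : ℕ) (δ t : ℝ) : ℝ := 2 * Real.log (Real.logb 2 t + 1) + Real.log (16 * K / δ)

lemma log_le_logFactor {K : ℕ} {δ t : ℝ} (ht : 1 ≤ t) : Real.log (16 * K / δ) ≤ logFactor K δ t := by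
  have h1 : 0 ≤ Real.logb 2 t := Real.logb_nonneg one_lt_two ht
  have := Real.log_nonneg (x := Real.logb 2 t + 1) (by linarith)
  unfold logFactor
  linarith

lemma log_sixteen_mul_div_pos {K : ℕ} {δ : ℝ} (hK : 1 ≤ K) (hδ0 : 0 < δ) (hδ1 : δ < 1) :
    0 < Real.log (16 * K / δ) := by
  apply Real.log_pos
  rw [lt_div_iff₀ hδ0]
  have : (1 : ℝ) ≤ K := by exact_mod_cast hK
  linarith

lemma logFactor_pos {K : ℕ} {δ t : ℝ} (hK : 1 ≤ K) (hδ0 : 0 < δ) (hδ1 : δ < 1) (ht : 1 ≤ t) :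
    0 < logFactor K δ t :=
  (log_sixteen_mul_div_pos hK hδ0 hδ1).trans_le (log_le_logFactor ht)

lemma eta_sq {K : ℕ} {δ t : ℝ} (hK : 1 ≤ K) (hδ0 : 0 < δ) (hδ1 : δ < 1) (ht : 1 ≤ t) :
    eta K δ t ^ 2 = logFactor K δ t / t :=
  Real.sq_sqrt (div_nonneg (logFactor_pos hK hδ0 hδ1 ht).le (by linarith))

lemma eta_nonneg (K : ℕ) (δ t : ℝ) : 0 ≤ eta K δ t := Real.sqrt_nonneg _

/-- The confidence statements about the losses evaluated in a group: the mean is within the radius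
of `r`, and the empirical variance is not much larger than `v`. -/
def IsAccurate {n : ℕ} (K : ℕ) (δ : ℝ) (Z : Fin n → ℝ) (r v : ℝ) (T : Finset (Fin n)) : Prop :=
  |empMean Z T - r| ≤ radius K δ (empVar Z T) T.card ∧ empVar Z T ≤ v + eta K δ T.card

/-- The last square explains the asymmetry of the radius: dropping it bounds the empirical variance
by `v + η`, while bounding `v` by the empirical variance costs `η + η ^ 2`. -/
lemma empVar_eq {n : ℕ} (Z : Fin n → ℝ) (r v : ℝ) {T : Finset (Fin n)} (hT : T.Nonempty) :
    empVar Z T = v + (∑ i ∈ T, ((Z i - r) ^ 2 - v)) / T.card - (empMean Z T - r) ^ 2 := by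
  have hc : (T.card : ℝ) ≠ 0 := by exact_mod_cast hT.card_pos.ne'
  have hs : ∑ i ∈ T, Z i = T.card * empMean Z T := by unfold empMean; field_simp
  unfold empVar
  rw [eq_sub_iff_add_eq, ← sub_eq_iff_eq_add', div_add' _ _ _ hc, sub_eq_iff_eq_add',
    div_eq_iff hc, add_mul, div_mul_cancel₀ _ hc]
  have e : ∀ i, (Z i - empMean Z T) ^ 2 =
      ((Z i - r) ^ 2 - v) + (v + (empMean Z T ^ 2 - r ^ 2)) - 2 * (empMean Z T - r) * Z i := by
    intro i; ring
  simp_rw [e]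
  rw [Finset.sum_sub_distrib, Finset.sum_add_distrib, ← Finset.mul_sum, hs]
  simp only [Finset.sum_const, nsmul_eq_mul]
  ring

lemma sum_sub_eq {n : ℕ} (Z : Fin n → ℝ) (r : ℝ) {T : Finset (Fin n)} (hT : T.Nonempty) :
    (∑ i ∈ T, (Z i - r)) / T.card = empMean Z T - r := by
  have hc : (T.card : ℝ) ≠ 0 := by exact_mod_cast hT.card_pos.ne'
  unfold empMean
  rw [Finset.sum_sub_distrib, sub_div]
  simp [hc]

/-- The two Hoeffding bounds become deviations of at most `η` for the mean and the centred second
moment, because `M * l / 2 ≤ (t η) ^ 2`. They let the empirical variance replace `v` in the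
Bernstein bound, whose two terms then match those of `radius`. -/
lemma isAccurate_of_sum_lt {n K : ℕ} {δ : ℝ} (hK : 1 ≤ K) (hδ0 : 0 < δ) (hδ1 : δ < 1)
    {Z : Fin n → ℝ} {r v : ℝ} (hv : 0 ≤ v) {T : Finset (Fin n)} (hT : T.Nonempty) {M l : ℝ}
    (hl0 : 0 ≤ l)
    (hM : M ≤ 2 * T.card) (hl : l ≤ logFactor K δ T.card)
    (hH : |∑ i ∈ T, (Z i - r)| < √(M * l / 2))
    (hV : |∑ i ∈ T, ((Z i - r) ^ 2 - v)| < √(M * l / 2))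
    (hB : |∑ i ∈ T, (Z i - r)| < √(2 * M * v * l) + 2 * l / 3) :
    IsAccurate K δ Z r v T := by
  set t : ℝ := (T.card : ℝ) with ht
  have ht1 : 1 ≤ t := Nat.one_le_cast.2 hT.card_pos
  have ht0 : 0 < t := by linarith
  set e := eta K δ t with he
  have he0 : 0 ≤ e := eta_nonneg _ _ _
  have he2 : logFactor K δ t = t * e ^ 2 := by
    rw [he, eta_sq hK hδ0 hδ1 ht1]; field_simp
  have hML : M * l / 2 ≤ (t * e) ^ 2 := by
    have : M * l ≤ (2 * t) * (t * e ^ 2) := by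
      rw [← he2]; gcongr
    nlinarith
  have hx : √(M * l / 2) ≤ t * e := by
    rw [← Real.sqrt_sq (mul_nonneg ht0.le he0)]
    exact Real.sqrt_le_sqrt hML
  have hHe : |empMean Z T - r| ≤ e := by
    rw [← sum_sub_eq Z r hT, abs_div, abs_of_pos ht0, div_le_iff₀ ht0]
    linarith
  have hVe : |(∑ i ∈ T, ((Z i - r) ^ 2 - v)) / t| ≤ e := by
    rw [abs_div, abs_of_pos ht0, div_le_iff₀ ht0]
    linarith
  have hev := empVar_eq Z r v hT
  have hsq : (empMean Z T - r) ^ 2 ≤ e ^ 2 := sq_le_sq' (by linarith [(abs_le.1 hHe).1]) (abs_le.1 hHe).2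
  have hVe' := abs_le.1 hVe
  refine ⟨?_, by rw [hev]; nlinarith [sq_nonneg (empMean Z T - r)]⟩
  have hvle : v ≤ empVar Z T + e + e ^ 2 := by rw [hev]; linarith
  have hBe : √(2 * M * v * l) ≤ t * (2 * √(v * e ^ 2)) := by
    have h1 : 2 * M * v * l ≤ (2 * t) ^ 2 * (v * e ^ 2) := by
      have : M * l * v ≤ (2 * (t * e) ^ 2) * v := by
        apply mul_le_mul_of_nonneg_right _ hv; linarith
      nlinarith
    calc _ ≤ √((2 * t) ^ 2 * (v * e ^ 2)) := Real.sqrt_le_sqrt h1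
      _ = _ := by
        rw [Real.sqrt_mul (sq_nonneg _), Real.sqrt_sq (by positivity)]; ring
  have hrad : t * (2 * √(v * e ^ 2)) + 2 * (t * e ^ 2) / 3 ≤ t * radius K δ (empVar Z T) t := by
    have : √(v * e ^ 2) ≤ √((empVar Z T + e + e ^ 2) * e ^ 2) := by
      apply Real.sqrt_le_sqrt; gcongr
    unfold radius
    rw [← he]
    nlinarith
  rw [← sum_sub_eq Z r hT, abs_div, abs_of_pos ht0, div_le_iff₀ ht0]
  rw [he2] at hl
  linarith

/-- Block `b` holds the sizes between `2 ^ b` and `2 ^ (b + 1)`. Its level is chosen so that the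
failure probabilities are summable in `b`; this is what the iterated logarithm in `eta` pays for. -/
lemma exists_dyadic {n K : ℕ} {δ : ℝ} (hK : 1 ≤ K) (hδ0 : 0 < δ) {T : Finset (Fin n)}
    (hT : T.Nonempty) :
    ∃ b : ℕ, T.card ≤ 2 ^ (b + 1) ∧ 2 ^ (b + 1) ≤ 2 * T.card ∧
      Real.log (16 * K * (b + 1) ^ 2 / δ) ≤ logFactor K δ T.card := by
  have hc : T.card ≠ 0 := hT.card_pos.ne'
  refine ⟨Nat.log 2 T.card, (Nat.lt_pow_succ_log_self one_lt_two _).le, ?_, ?_⟩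
  · rw [pow_succ, mul_comm]
    exact Nat.mul_le_mul_left 2 (Nat.pow_log_le_self 2 hc)
  · have hb : (Nat.log 2 T.card : ℝ) ≤ Real.logb 2 T.card := by
      have := Real.natLog_le_logb T.card 2
      exact_mod_cast this
    have hK' : (1 : ℝ) ≤ K := by exact_mod_cast hK
    rw [show (16 * K * ((Nat.log 2 T.card : ℝ) + 1) ^ 2 / δ) =
      ((Nat.log 2 T.card : ℝ) + 1) ^ 2 * (16 * K / δ) by ring,
      Real.log_mul (by positivity) (by positivity), Real.log_pow]
    unfold logFactor
    push_cast
    gcongr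

lemma sum_inv_succ_sq_le (N : ℕ) :
    ∑ b ∈ Finset.range N, (1 : ℝ) / ((b : ℝ) + 1) ^ 2 ≤ 2 - 1 / (N : ℝ) := by
  induction N with
  | zero => simp
  | succ N ih =>
    rw [Finset.sum_range_succ]
    push_cast
    rcases Nat.eq_zero_or_pos N with rfl | hN
    · norm_num
    have hN' : (0 : ℝ) < N := by exact_mod_cast hN
    have : (1 : ℝ) / ((N : ℝ) + 1) ^ 2 ≤ 1 / N - 1 / (N + 1) := by
      rw [div_sub_div _ _ hN'.ne' (by positivity), div_le_div_iff₀ (by positivity) (by positivity)]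
      nlinarith
    linarith

/-! ### Uniform accuracy within one group -/

section Group

variable {Ω : Type*} [MeasurableSpace Ω] {μ : Measure Ω} [IsProbabilityMeasure μ]

/-- Along a chain of sets of indices of independent losses with a common mean and variance, the
confidence statements hold simultaneously with high probability. -/
lemma measure_exists_not_isAccurate_le {n K : ℕ} {δ : ℝ} (hK : 1 ≤ K) (hδ0 : 0 < δ) (hδ1 : δ < 1)
    {Z : Fin n → Ω → ℝ} (hZ : iIndepFun Z μ) (hm : ∀ i, Measurable (Z i))
    (hb : ∀ i ω, Z i ω ∈ Set.Icc 0 1) {G : Finset (Fin n)} {r v : ℝ}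
    (hr : ∀ i ∈ G, ∫ ω, Z i ω ∂μ = r) (hv : ∀ i ∈ G, ∫ ω, (Z i ω - r) ^ 2 ∂μ = v)
    {T : ℕ → Finset (Fin n)} (hT : Monotone T) (hG : ∀ j, T j ⊆ G) :
    μ {ω | ∃ j, (T j).Nonempty ∧ ¬ IsAccurate K δ (fun i => Z i ω) r v (T j)} ≤
      ENNReal.ofReal (δ / K) := by
  rcases G.eq_empty_or_nonempty with rfl | ⟨i₀, hi₀⟩
  · have : {ω | ∃ j, (T j).Nonempty ∧ ¬ IsAccurate K δ (fun i => Z i ω) r v (T j)} = ∅ := by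
      refine Set.eq_empty_of_forall_notMem fun ω => ?_
      rintro ⟨j, hj, -⟩
      obtain ⟨i, hi⟩ := hj
      exact absurd (hG j hi) (Finset.notMem_empty i)
    simp [this]
  have hK0 : (0 : ℝ) < K := by exact_mod_cast hK
  have hi : ∀ i, Integrable (Z i) μ := fun i => integrable_of_mem_Icc (hm i) (hb i)
  have hr0 : 0 ≤ r := by
    rw [← hr i₀ hi₀]; exact integral_nonneg fun ω => (hb i₀ ω).1
  have hr1 : r ≤ 1 := by
    rw [← hr i₀ hi₀]
    calc _ ≤ ∫ _, (1 : ℝ) ∂μ := integral_mono (hi i₀) (integrable_const _) fun ω => (hb i₀ ω).2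
      _ = 1 := by simp
  have hv0 : 0 ≤ v := by
    rw [← hv i₀ hi₀]; exact integral_nonneg fun ω => sq_nonneg _
  have hDb : ∀ i ω, Z i ω - r ∈ Set.Icc (-r) (-r + 1) := fun i ω =>
    ⟨by linarith [(hb i ω).1], by linarith [(hb i ω).2]⟩
  have hDb' : ∀ i ω, r - Z i ω ∈ Set.Icc (r - 1) (r - 1 + 1) := fun i ω =>
    ⟨by linarith [(hb i ω).2], by linarith [(hb i ω).1]⟩
  have hDB : ∀ i ω, Z i ω - r ∈ Set.Icc (-1) 1 := fun i ω =>
    ⟨by linarith [(hb i ω).1], by linarith [(hb i ω).2]⟩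
  have hDB' : ∀ i ω, r - Z i ω ∈ Set.Icc (-1) 1 := fun i ω =>
    ⟨by linarith [(hb i ω).2], by linarith [(hb i ω).1]⟩
  have hsq : ∀ i ω, (Z i ω - r) ^ 2 ∈ Set.Icc 0 1 := fun i ω =>
    ⟨sq_nonneg _, by nlinarith [(hDB i ω).1, (hDB i ω).2]⟩
  have hVb : ∀ i ω, (Z i ω - r) ^ 2 - v ∈ Set.Icc (-v) (-v + 1) := fun i ω =>
    ⟨by linarith [(hsq i ω).1], by linarith [(hsq i ω).2]⟩
  have hVb' : ∀ i ω, v - (Z i ω - r) ^ 2 ∈ Set.Icc (v - 1) (v - 1 + 1) := fun i ω =>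
    ⟨by linarith [(hsq i ω).2], by linarith [(hsq i ω).1]⟩
  have hD0 : ∀ i ∈ G, ∫ ω, (Z i ω - r) ∂μ = 0 := fun i h => by
    rw [integral_sub (hi i) (integrable_const _), hr i h]; simp
  have hD0' : ∀ i ∈ G, ∫ ω, (r - Z i ω) ∂μ = 0 := fun i h => by
    rw [integral_sub (integrable_const _) (hi i), hr i h]; simp
  have hsqm : ∀ i, Measurable fun ω => (Z i ω - r) ^ 2 := fun i => ((hm i).sub_const r).pow_const 2
  have hsqi : ∀ i, Integrable (fun ω => (Z i ω - r) ^ 2) μ := fun i =>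
    integrable_of_mem_Icc (hsqm i) (hsq i)
  have hV0 : ∀ i ∈ G, ∫ ω, ((Z i ω - r) ^ 2 - v) ∂μ = 0 := fun i h => by
    rw [integral_sub (hsqi i) (integrable_const _), hv i h]; simp
  have hV0' : ∀ i ∈ G, ∫ ω, (v - (Z i ω - r) ^ 2) ∂μ = 0 := fun i h => by
    rw [integral_sub (integrable_const _) (hsqi i), hv i h]; simp
  have hv' : ∀ i ∈ G, ∫ ω, (r - Z i ω) ^ 2 ∂μ = v := fun i h => by
    rw [← hv i h]; exact integral_congr_ae (ae_of_all _ fun ω => by ring)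
  have hDI : iIndepFun (fun i ω => Z i ω - r) μ :=
    hZ.comp (fun _ x => x - r) fun _ => by fun_prop
  have hDI' : iIndepFun (fun i ω => r - Z i ω) μ :=
    hZ.comp (fun _ x => r - x) fun _ => by fun_prop
  have hVI : iIndepFun (fun i ω => (Z i ω - r) ^ 2 - v) μ :=
    hZ.comp (fun _ x => (x - r) ^ 2 - v) fun _ => by fun_prop
  have hVI' : iIndepFun (fun i ω => v - (Z i ω - r) ^ 2) μ :=
    hZ.comp (fun _ x => v - (x - r) ^ 2) fun _ => by fun_prop
  let M : ℕ → ℕ := fun b => 2 ^ (b + 1)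
  let l : ℕ → ℝ := fun b => Real.log (16 * K * ((b : ℝ) + 1) ^ 2 / δ)
  have hl : ∀ b, 0 < l b := fun b => by
    refine Real.log_pos ((one_lt_div hδ0).2 ?_)
    have h1 : (1 : ℝ) ≤ K := by exact_mod_cast hK
    have h2 : (1 : ℝ) ≤ ((b : ℝ) + 1) ^ 2 := one_le_pow₀ (by linarith [Nat.cast_nonneg (α := ℝ) b])
    nlinarith
  let p : ℕ → ENNReal := fun b => ENNReal.ofReal (Real.exp (-l b))
  let E : (Fin n → Ω → ℝ) → ℕ → ℝ → Set Ω := fun X b x =>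
    {ω | ∃ j, (T j).card ≤ M b ∧ x ≤ ∑ i ∈ T j, X i ω}
  let W : ℕ → Set Ω := fun b =>
    E (fun i ω => Z i ω - r) b √(M b * l b / 2) ∪ E (fun i ω => r - Z i ω) b √(M b * l b / 2) ∪
    E (fun i ω => (Z i ω - r) ^ 2 - v) b √(M b * l b / 2) ∪
    E (fun i ω => v - (Z i ω - r) ^ 2) b √(M b * l b / 2) ∪
    E (fun i ω => Z i ω - r) b (√(2 * M b * v * l b) + 2 * l b / 3) ∪
    E (fun i ω => r - Z i ω) b (√(2 * M b * v * l b) + 2 * l b / 3)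
  have hMp : ∀ b, 0 < M b := fun b => Nat.two_pow_pos _
  have hW : ∀ b, μ (W b) ≤ 6 * p b := by
    intro b
    have u1 : μ (E (fun i ω => Z i ω - r) b √(M b * l b / 2)) ≤ p b :=
      measure_exists_hoeffding_le hDI (fun i => by fun_prop) hDb hT hG hD0 (hMp b) (hl b).le
    have u2 : μ (E (fun i ω => r - Z i ω) b √(M b * l b / 2)) ≤ p b :=
      measure_exists_hoeffding_le hDI' (fun i => by fun_prop) hDb' hT hG hD0' (hMp b) (hl b).le
    have u3 : μ (E (fun i ω => (Z i ω - r) ^ 2 - v) b √(M b * l b / 2)) ≤ p b :=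
      measure_exists_hoeffding_le hVI (fun i => by fun_prop) hVb hT hG hV0 (hMp b) (hl b).le
    have u4 : μ (E (fun i ω => v - (Z i ω - r) ^ 2) b √(M b * l b / 2)) ≤ p b :=
      measure_exists_hoeffding_le hVI' (fun i => by fun_prop) hVb' hT hG hV0' (hMp b) (hl b).le
    have u5 : μ (E (fun i ω => Z i ω - r) b (√(2 * M b * v * l b) + 2 * l b / 3)) ≤ p b :=
      measure_exists_bernstein_le hDI (fun i => by fun_prop) hDB hT hG hD0 hv0 hv (M b) (hl b)
    have u6 : μ (E (fun i ω => r - Z i ω) b (√(2 * M b * v * l b) + 2 * l b / 3)) ≤ p b :=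
      measure_exists_bernstein_le hDI' (fun i => by fun_prop) hDB' hT hG hD0' hv0 hv' (M b) (hl b)
    calc μ (W b) ≤ p b + p b + p b + p b + p b + p b :=
          (measure_union_le _ _).trans (add_le_add ((measure_union_le _ _).trans (add_le_add
            ((measure_union_le _ _).trans (add_le_add ((measure_union_le _ _).trans (add_le_add
              ((measure_union_le _ _).trans (add_le_add u1 u2)) u3)) u4)) u5)) u6)
      _ = 6 * p b := by ring
  have hsub : {ω | ∃ j, (T j).Nonempty ∧ ¬ IsAccurate K δ (fun i => Z i ω) r v (T j)} ⊆
      ⋃ b, W b := by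
    rintro ω ⟨j, hj, hacc⟩
    obtain ⟨b, hb1, hb2, hb3⟩ := exists_dyadic hK hδ0 hj
    refine Set.mem_iUnion.2 ⟨b, ?_⟩
    by_contra hω
    apply hacc
    simp only [W, E, Set.mem_union, not_or, Set.mem_ofPred_eq, not_exists, not_and, not_le] at hω
    obtain ⟨⟨⟨⟨⟨w1, w2⟩, w3⟩, w4⟩, w5⟩, w6⟩ := hω
    have n1 : ∑ i ∈ T j, (r - Z i ω) = -∑ i ∈ T j, (Z i ω - r) := by
      rw [← Finset.sum_neg_distrib]; exact Finset.sum_congr rfl fun i _ => by ring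
    have n2 : ∑ i ∈ T j, (v - (Z i ω - r) ^ 2) = -∑ i ∈ T j, ((Z i ω - r) ^ 2 - v) := by
      rw [← Finset.sum_neg_distrib]; exact Finset.sum_congr rfl fun i _ => by ring
    refine isAccurate_of_sum_lt hK hδ0 hδ1 hv0 hj (M := M b) (l := l b)
      (hl b).le (by exact_mod_cast hb2) hb3 ?_ ?_ ?_
    · exact abs_lt.2 ⟨by have := w2 j hb1; rw [n1] at this; linarith, w1 j hb1⟩
    · exact abs_lt.2 ⟨by have := w4 j hb1; rw [n2] at this; linarith, w3 j hb1⟩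
    · exact abs_lt.2 ⟨by have := w6 j hb1; rw [n1] at this; linarith, w5 j hb1⟩
  have hp : ∀ b, 6 * p b = ENNReal.ofReal (6 * (δ / (16 * K) * (1 / ((b : ℝ) + 1) ^ 2))) := by
    intro b
    simp only [p, l]
    rw [Real.exp_neg, Real.exp_log (by positivity), ENNReal.ofReal_mul (by norm_num)]
    simp only [ENNReal.ofReal_ofNat]
    congr 2
    field_simp
  refine (measure_mono hsub).trans ((measure_iUnion_le _).trans ?_)
  refine ENNReal.tsum_le_of_sum_range_le fun N => ?_
  calc ∑ b ∈ Finset.range N, μ (W b) ≤ ∑ b ∈ Finset.range N, 6 * p b :=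
        Finset.sum_le_sum fun b _ => hW b
    _ = ENNReal.ofReal (∑ b ∈ Finset.range N, 6 * (δ / (16 * K) * (1 / ((b : ℝ) + 1) ^ 2))) := by
        simp_rw [hp]
        rw [ENNReal.ofReal_sum_of_nonneg fun b _ => by positivity]
    _ ≤ ENNReal.ofReal (δ / K) := by
        refine ENNReal.ofReal_le_ofReal ?_
        rw [← Finset.mul_sum, ← Finset.mul_sum]
        have h1 := sum_inv_succ_sq_le N
        have h2 : (0 : ℝ) ≤ 1 / N := by positivity
        have h3 : ∑ b ∈ Finset.range N, (1 : ℝ) / ((b : ℝ) + 1) ^ 2 ≤ 2 := by linarith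
        have h4 : 6 * (δ / (16 * K) * ∑ b ∈ Finset.range N, (1 : ℝ) / ((b : ℝ) + 1) ^ 2) ≤
            6 * (δ / (16 * K) * 2) := by gcongr
        refine h4.trans ?_
        -- Six tail events per block, each of probability `δ / (16 K (b + 1) ^ 2)`, and a series
        -- bounded by two: `12 / 16` of the allowance `δ / K` is used.
        rw [show 6 * (δ / (16 * K) * 2) = (3 / 4) * (δ / K) by field_simp; norm_num]
        have : 0 < δ / K := by positivity
        linarith

end Group

/-! ### The law of the data given the split -/

lemma cond_pi_univ_pi {n : ℕ} {α : Type*} [MeasurableSpace α] (μ : Measure α)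
    [IsProbabilityMeasure μ] {B : Fin n → Set α} (hB : ∀ i, MeasurableSet (B i))
    (h0 : ∀ i, μ (B i) ≠ 0) :
    (Measure.pi fun _ : Fin n => μ)[|Set.univ.pi B] = Measure.pi fun i => μ[|B i] := by
  have : ∀ i, IsProbabilityMeasure (μ[|B i]) := fun i => cond_isProbabilityMeasure (h0 i)
  refine (Measure.pi_eq fun s hs => ?_).symm
  rw [cond_apply (MeasurableSet.univ_pi hB), ← Set.pi_inter_distrib, Measure.pi_pi, Measure.pi_pi,
    ENNReal.prod_inv_distrib, ← Finset.prod_mul_distrib]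
  · exact Finset.prod_congr rfl fun i _ => (cond_apply (hB i) μ (s i)).symm
  · intro i _ j _ _
    exact Or.inl (h0 i)

section Cell

variable {𝒳 𝒴 : Type*} {n K : ℕ} {A : Fin K → Set (𝒳 × 𝒴)}

/-- The points that land in the parts prescribed for the index `i` by the split `G`. -/
def cell (A : Fin K → Set (𝒳 × 𝒴)) (G : Fin K → Finset (Fin n)) (i : Fin n) :
    Set ((𝒳 × 𝒴) × 𝒴) :=
  {z | ∀ k, z.1 ∈ A k ↔ i ∈ G k}

/-- Which groups contain point `i` depends on coordinate `i` alone, so the split is a product event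
and conditioning on it preserves independence. -/
lemma setOf_groupsOf_eq (A : Fin K → Set (𝒳 × 𝒴)) (G : Fin K → Finset (Fin n)) :
    {ω : Fin n → (𝒳 × 𝒴) × 𝒴 | groupsOf A (fun i => (ω i).1) = G} = Set.univ.pi (cell A G) := by
  ext ω
  simp only [Set.mem_ofPred_eq, Set.mem_univ_pi, cell, funext_iff, Finset.ext_iff, groupsOf,
    Finset.mem_filter, Finset.mem_univ, true_and]
  exact forall_comm

lemma cell_eq_preimage (hdisj : Pairwise fun j k => Disjoint (A j) (A k))
    {G : Fin K → Finset (Fin n)} (hG : Pairwise fun j k => Disjoint (G j) (G k)) {i : Fin n}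
    {k : Fin K} (hi : i ∈ G k) : cell A G i = Prod.fst ⁻¹' A k := by
  ext z
  simp only [cell, Set.mem_ofPred_eq, Set.mem_preimage]
  refine ⟨fun h => (h k).2 hi, fun h j => ?_⟩
  rcases eq_or_ne j k with rfl | hjk
  · simp [h, hi]
  · exact iff_of_false (fun h' => Set.disjoint_left.1 (hdisj hjk) h' h)
      fun h' => Finset.disjoint_left.1 (hG hjk) h' hi

end Cell

section Task

variable {𝒳 𝒴 : Type*} [MeasurableSpace 𝒳] [MeasurableSpace 𝒴]
  {P : Measure (𝒳 × 𝒴)} [IsProbabilityMeasure P] {f : Kernel 𝒳 𝒴} [IsMarkovKernel f]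
  {ℓ : 𝒴 → 𝒴 → ℝ} {n K : ℕ} {A : Fin K → Set (𝒳 × 𝒴)}

instance : IsProbabilityMeasure (evalLaw P f) := by unfold evalLaw; infer_instance

lemma evalLaw_preimage_fst {S : Set (𝒳 × 𝒴)} (hS : MeasurableSet S) :
    evalLaw P f (Prod.fst ⁻¹' S) = P S := by
  rw [← Measure.fst_apply hS, evalLaw, Measure.fst_compProd]

lemma measurable_lossAt (hℓ : Measurable fun p : 𝒴 × 𝒴 => ℓ p.1 p.2) :
    Measurable (lossAt ℓ : (𝒳 × 𝒴) × 𝒴 → ℝ) :=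
  hℓ.comp (measurable_snd.prodMk (measurable_snd.comp measurable_fst))

/-- The conditional mean of the loss in the group `S`. -/
noncomputable def condRisk (P : Measure (𝒳 × 𝒴)) (f : Kernel 𝒳 𝒴) (ℓ : 𝒴 → 𝒴 → ℝ)
    (S : Set (𝒳 × 𝒴)) : ℝ :=
  ∫ z, lossAt ℓ z ∂((evalLaw P f)[|Prod.fst ⁻¹' S])

lemma risk_eq_sum (hℓ : Measurable fun p : 𝒴 × 𝒴 => ℓ p.1 p.2)
    (hℓb : ∀ y y', 0 ≤ ℓ y y' ∧ ℓ y y' ≤ 1) (hA : ∀ k, MeasurableSet (A k))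
    (hdisj : Pairwise fun j k => Disjoint (A j) (A k)) (hcov : ∀ᵐ z ∂P, ∃ k, z ∈ A k) :
    risk P f ℓ = ∑ k, P.real (A k) * condRisk P f ℓ (A k) := by
  have hm := measurable_lossAt (𝒳 := 𝒳) hℓ
  have hi : Integrable (lossAt ℓ) (evalLaw P f) :=
    integrable_of_mem_Icc hm (a := 0) (b := 1) fun z => hℓb _ _
  have hpre : ∀ k, MeasurableSet (Prod.fst ⁻¹' A k : Set ((𝒳 × 𝒴) × 𝒴)) :=
    fun k => measurable_fst (hA k)
  have hU : (⋃ k, (Prod.fst ⁻¹' A k : Set ((𝒳 × 𝒴) × 𝒴))) =ᵐ[evalLaw P f] Set.univ := by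
    rw [← Set.preimage_iUnion, ae_eq_univ, ← Set.preimage_compl,
      evalLaw_preimage_fst (MeasurableSet.iUnion hA).compl]
    convert hcov using 1
    rw [ae_iff]
    congr! 2
    ext z
    simp
  have hterm : ∀ k, P.real (A k) * condRisk P f ℓ (A k) =
      ∫ z in Prod.fst ⁻¹' A k, lossAt ℓ z ∂(evalLaw P f) := by
    intro k
    unfold condRisk
    by_cases h0 : evalLaw P f (Prod.fst ⁻¹' A k) = 0
    · rw [Measure.restrict_eq_zero.2 h0, measureReal_def, ← evalLaw_preimage_fst (f := f) (hA k), h0]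
      simp
    · rw [ProbabilityTheory.cond, integral_smul_measure, measureReal_def,
        ← evalLaw_preimage_fst (f := f) (hA k), ENNReal.toReal_inv, smul_eq_mul, ← mul_assoc,
        mul_inv_cancel₀, one_mul]
      exact (ENNReal.toReal_pos h0 (measure_ne_top _ _)).ne'
  simp_rw [hterm]
  rw [← integral_iUnion_fintype hpre
    (fun j k hjk => (hdisj hjk).preimage _) fun k => hi.integrableOn,
    Measure.restrict_congr_set hU, Measure.restrict_univ]
  rfl

lemma measurableSet_cell (hA : ∀ k, MeasurableSet (A k)) (G : Fin K → Finset (Fin n)) (i : Fin n) :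
    MeasurableSet (cell A G i) := by
  have : cell A G i = ⋂ k, {z | z.1 ∈ A k ↔ i ∈ G k} := by ext z; simp [cell]
  rw [this]
  refine MeasurableSet.iInter fun k => ?_
  by_cases h : i ∈ G k
  · simp only [h, iff_true]
    exact measurable_fst (hA k)
  · simp only [h, iff_false]
    exact (measurable_fst (hA k)).compl

/-- Conditionally on a split of positive probability, the losses are independent, and within a
group they have the conditional mean and variance of the group. -/
lemma dataLaw_spec (hℓ : Measurable fun p : 𝒴 × 𝒴 => ℓ p.1 p.2) (hA : ∀ k, MeasurableSet (A k))
    (hdisj : Pairwise fun j k => Disjoint (A j) (A k)) (hcov : ∀ᵐ z ∂P, ∃ k, z ∈ A k)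
    (G : Fin K → Finset (Fin n)) (h : dataLaw P f A G ≠ 0) :
    IsProbabilityMeasure (dataLaw P f A G) ∧
    (∀ᵐ ω ∂dataLaw P f A G, groupsOf A (fun i => (ω i).1) = G) ∧
    (∀ i, ∃ k, i ∈ G k) ∧ (Pairwise fun j k => Disjoint (G j) (G k)) ∧
    iIndepFun (fun i ω => lossAt ℓ (ω i)) (dataLaw P f A G) ∧
    ∀ k, ∀ i ∈ G k, ∫ ω, lossAt ℓ (ω i) ∂(dataLaw P f A G) = condRisk P f ℓ (A k) ∧
      ∫ ω, (lossAt ℓ (ω i) - condRisk P f ℓ (A k)) ^ 2 ∂(dataLaw P f A G) =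
        condVar P f ℓ (A k) := by
  have hm := measurable_lossAt (𝒳 := 𝒳) hℓ
  have hcell := measurableSet_cell hA G
  have hE : MeasurableSet {ω : Fin n → (𝒳 × 𝒴) × 𝒴 | groupsOf A (fun i => (ω i).1) = G} := by
    rw [setOf_groupsOf_eq]; exact MeasurableSet.univ_pi hcell
  have hpos : (Measure.pi fun _ : Fin n => evalLaw P f)
      {ω | groupsOf A (fun i => (ω i).1) = G} ≠ 0 := fun h0 => h (cond_eq_zero_of_meas_eq_zero h0)
  have hpos' := hpos
  rw [setOf_groupsOf_eq, Measure.pi_pi, Finset.prod_ne_zero_iff] at hpos'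
  have hc0 : ∀ i, evalLaw P f (cell A G i) ≠ 0 := fun i => hpos' i (Finset.mem_univ i)
  have hpi : dataLaw P f A G = Measure.pi fun i => (evalLaw P f)[|cell A G i] := by
    unfold dataLaw
    rw [setOf_groupsOf_eq]
    exact cond_pi_univ_pi _ hcell hc0
  have hne : ∀ i, (cell A G i).Nonempty := fun i => nonempty_of_measure_ne_zero (hc0 i)
  have hGd : Pairwise fun j k => Disjoint (G j) (G k) := by
    intro j k hjk
    refine Finset.disjoint_left.2 fun i hj hk => ?_
    obtain ⟨z, hz⟩ := hne i
    exact Set.disjoint_left.1 (hdisj hjk) ((hz j).2 hj) ((hz k).2 hk)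
  have hprob : ∀ i, IsProbabilityMeasure ((evalLaw P f)[|cell A G i]) :=
    fun i => cond_isProbabilityMeasure (hc0 i)
  refine ⟨cond_isProbabilityMeasure hpos, ae_cond_mem hE, ?_, hGd, ?_, ?_⟩
  · intro i
    by_contra hi
    push Not at hi
    apply hc0 i
    have : cell A G i ⊆ Prod.fst ⁻¹' (⋃ k, A k)ᶜ := by
      intro z hz
      simp only [Set.mem_preimage, Set.mem_compl_iff, Set.mem_iUnion, not_exists]
      exact fun k hk => hi k ((hz k).1 hk)
    refine measure_mono_null this ?_
    rw [evalLaw_preimage_fst (MeasurableSet.iUnion hA).compl]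
    rw [ae_iff] at hcov
    convert hcov using 2
    ext z
    simp
  · rw [hpi]
    exact iIndepFun_pi (X := fun _ => lossAt ℓ) fun i => hm.aemeasurable
  · intro k i hi
    have key : ∀ g : (𝒳 × 𝒴) × 𝒴 → ℝ, Measurable g → ∫ ω, g (ω i) ∂(dataLaw P f A G) =
        ∫ z, g z ∂((evalLaw P f)[|Prod.fst ⁻¹' A k]) := by
      intro g hg
      rw [hpi, ← cell_eq_preimage hdisj hGd hi,
        ← (measurePreserving_eval (fun i => (evalLaw P f)[|cell A G i]) i).map_eq,
        integral_map (measurable_pi_apply i).aemeasurable hg.aestronglyMeasurable]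
    refine ⟨key _ hm, ?_⟩
    rw [key (fun z => (lossAt ℓ z - condRisk P f ℓ (A k)) ^ 2) ((hm.sub_const _).pow_const 2),
      condVar, variance_eq_integral hm.aemeasurable]
    rfl

end Task

/-! ### The dynamics of the algorithm -/

/-- The parts of the dataset form a partition, and the selection rules are legitimate. -/
structure Input.IsAdmissible {n K : ℕ} (a : Input n K) : Prop where
  pickGroup_mem : ∀ s : Finset (Fin K), s.Nonempty → a.pickGroup s ∈ s
  pickPoint_mem : ∀ s : Finset (Fin n), s.Nonempty → a.pickPoint s ∈ s
  disjoint : Pairwise fun j k => Disjoint (a.group j) (a.group k)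
  exists_mem : ∀ i, ∃ k, i ∈ a.group k

/-- The points evaluated in the warm start. -/
def Input.warmStart {n K : ℕ} (a : Input n K) : Finset (Fin n) :=
  Finset.univ.filter fun i : Fin n => (i : ℕ) < a.m

/-- The sets of points of group `k` that may have been evaluated at some time. The order in which
the points of a group are evaluated does not depend on the losses. -/
def Input.chain {n K : ℕ} (a : Input n K) (k : Fin K) : ℕ → Finset (Fin n)
  | 0 => a.warmStart ∩ a.group k
  | j + 1 => if (a.group k \ a.chain k j).Nonempty then
      insert (a.pickPoint (a.group k \ a.chain k j)) (a.chain k j) else a.chain k j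

section Chain

variable {n K : ℕ} {a : Input n K}

lemma Input.chain_mono (k : Fin K) : Monotone (a.chain k) := by
  refine monotone_nat_of_le_succ fun j => ?_
  rw [Input.chain]
  split_ifs
  · exact Finset.subset_insert _ _
  · exact le_rfl

lemma Input.IsAdmissible.chain_subset (ha : a.IsAdmissible) (k : Fin K) (j : ℕ) :
    a.chain k j ⊆ a.group k := by
  induction j with
  | zero => exact Finset.inter_subset_right
  | succ j ih =>
    rw [Input.chain]
    split_ifs with h
    · exact Finset.insert_subset (Finset.mem_sdiff.1 (ha.pickPoint_mem _ h)).1 ih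
    · exact ih

end Chain

section Run

variable {n K : ℕ} {a : Input n K} {ε δ : ℝ} {Z : Fin n → ℝ} {S : Finset (Fin n)}

lemma targets_nonempty (ha : a.IsAdmissible) (hS : ¬ Stops a ε δ Z S) :
    (targets a δ Z S).Nonempty := by
  classical
  have hne : S ≠ Finset.univ := fun h => hS (Or.inr h)
  obtain ⟨i, hi⟩ : ∃ i, i ∉ S := by
    by_contra hc
    push Not at hc
    exact hne (Finset.eq_univ_iff_forall.2 hc)
  obtain ⟨k, hk⟩ := ha.exists_mem i
  have hopen : (openGroups a S).Nonempty :=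
    ⟨k, Finset.mem_filter.2 ⟨Finset.mem_univ k, fun h => hi (h hk)⟩⟩
  unfold targets
  split_ifs with h
  · exact h
  · obtain ⟨k, hk, hmax⟩ := Finset.exists_max_image _ (score a δ Z S) hopen
    exact ⟨k, Finset.mem_filter.2 ⟨hk, hmax⟩⟩

lemma targets_subset : targets a δ Z S ⊆ openGroups a S := by
  unfold targets
  split_ifs with h
  · exact Finset.filter_subset _ _
  · exact Finset.filter_subset _ _

lemma step_of_stops (hS : Stops a ε δ Z S) : step a ε δ Z S = S := if_pos hS

lemma exists_step_eq (ha : a.IsAdmissible) (hS : ¬ Stops a ε δ Z S) :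
    ∃ k ∈ targets a δ Z S, (a.group k \ S).Nonempty ∧
      step a ε δ Z S = insert (a.pickPoint (a.group k \ S)) S := by
  have hk := ha.pickGroup_mem _ (targets_nonempty ha hS)
  refine ⟨_, hk, ?_, ?_⟩
  · have := (Finset.mem_filter.1 (targets_subset hk)).2
    exact Finset.sdiff_nonempty.2 this
  · unfold step
    rw [if_neg hS]

lemma group_sdiff (k : Fin K) : a.group k \ S = a.group k \ (S ∩ a.group k) := by
  ext i; simp

lemma insert_inter_group_of_ne (ha : a.IsAdmissible) {j k : Fin K} (hjk : j ≠ k) {i : Fin n}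
    (hi : i ∈ a.group k) : insert i S ∩ a.group j = S ∩ a.group j :=
  Finset.insert_inter_of_notMem fun h => Finset.disjoint_left.1 (ha.disjoint hjk) h hi

lemma evaluated_succ (t : ℕ) :
    evaluated a ε δ Z (t + 1) = step a ε δ Z (evaluated a ε δ Z t) := by
  unfold evaluated
  rw [Function.iterate_succ_apply']

lemma evaluated_mono : Monotone (evaluated a ε δ Z) := by
  refine monotone_nat_of_le_succ fun t => ?_
  rw [evaluated_succ]
  unfold step
  split_ifs
  · exact le_rfl
  · exact Finset.subset_insert _ _

/-- `pickPoint` is applied to `a.group k \ S`, which depends on `S` only through `S ∩ a.group k`.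
The losses thus decide how far along the chain a group is, not the chain itself. -/
lemma evaluated_inter_group (ha : a.IsAdmissible) (t : ℕ) (k : Fin K) :
    ∃ j, evaluated a ε δ Z t ∩ a.group k = a.chain k j := by
  induction t with
  | zero => exact ⟨0, rfl⟩
  | succ t ih =>
    obtain ⟨j, hj⟩ := ih
    rw [evaluated_succ]
    by_cases hS : Stops a ε δ Z (evaluated a ε δ Z t)
    · exact ⟨j, by rw [step_of_stops hS, hj]⟩
    · obtain ⟨k', -, hne, hstep⟩ := exists_step_eq ha hS
      have hp := (Finset.mem_sdiff.1 (ha.pickPoint_mem _ hne)).1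
      rw [hstep]
      rcases eq_or_ne k k' with rfl | hkk
      · refine ⟨j + 1, ?_⟩
        rw [Finset.insert_inter_of_mem hp, hj, Input.chain]
        rw [group_sdiff, hj] at hne
        rw [if_pos hne, group_sdiff (S := evaluated a ε δ Z t), hj]
      · exact ⟨j, by rw [insert_inter_group_of_ne ha hkk hp, hj]⟩

/-- If points of group `k` have been evaluated after the warm start, then `k` was the target at the
last time this happened. -/
lemma exists_last_pick (ha : a.IsAdmissible) {t : ℕ} {k : Fin K}
    (hk : (a.warmStart ∩ a.group k).card < (evaluated a ε δ Z t ∩ a.group k).card) :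
    ∃ s < t, ¬ Stops a ε δ Z (evaluated a ε δ Z s) ∧
      k ∈ targets a δ Z (evaluated a ε δ Z s) ∧
      (evaluated a ε δ Z s ∩ a.group k).card + 1 = (evaluated a ε δ Z t ∩ a.group k).card := by
  induction t with
  | zero => exact absurd hk (lt_irrefl _)
  | succ t ih =>
    have hsame : evaluated a ε δ Z (t + 1) ∩ a.group k = evaluated a ε δ Z t ∩ a.group k →
        ∃ s < t + 1, ¬ Stops a ε δ Z (evaluated a ε δ Z s) ∧
        k ∈ targets a δ Z (evaluated a ε δ Z s) ∧
        (evaluated a ε δ Z s ∩ a.group k).card + 1 =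
          (evaluated a ε δ Z (t + 1) ∩ a.group k).card := by
      intro h
      rw [h] at hk ⊢
      obtain ⟨s, hs, h1⟩ := ih hk
      exact ⟨s, hs.trans (Nat.lt_succ_self t), h1⟩
    by_cases hS : Stops a ε δ Z (evaluated a ε δ Z t)
    · exact hsame (by rw [evaluated_succ, step_of_stops hS])
    · obtain ⟨k', hk', hne, hstep⟩ := exists_step_eq ha hS
      have hp := Finset.mem_sdiff.1 (ha.pickPoint_mem _ hne)
      rcases eq_or_ne k k' with rfl | hkk
      · refine ⟨t, Nat.lt_succ_self t, hS, hk', ?_⟩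
        rw [evaluated_succ, hstep, Finset.insert_inter_of_mem hp.1, Finset.card_insert_of_notMem]
        exact fun h => hp.2 (Finset.mem_inter.1 h).1
      · exact hsame (by rw [evaluated_succ, hstep, insert_inter_group_of_ne ha hkk hp.1])

lemma card_eq_sum_card_inter (ha : a.IsAdmissible) (S : Finset (Fin n)) :
    S.card = ∑ k, (S ∩ a.group k).card := by
  have hS : S = Finset.univ.biUnion fun k => S ∩ a.group k := by
    ext i
    simp only [Finset.mem_biUnion, Finset.mem_univ, true_and, Finset.mem_inter]
    exact ⟨fun h => (ha.exists_mem i).imp fun k hk => ⟨h, hk⟩, fun ⟨_, h, _⟩ => h⟩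
  conv_lhs => rw [hS]
  exact Finset.card_biUnion fun j _ k _ hjk =>
    (ha.disjoint hjk).mono Finset.inter_subset_right Finset.inter_subset_right

lemma card_warmStart_le : a.warmStart.card ≤ a.m := by
  have : a.warmStart.map Fin.valEmbedding ⊆ Finset.range a.m := by
    intro i
    simp only [Finset.mem_map, Input.warmStart, Finset.mem_filter]
    rintro ⟨j, hj, rfl⟩
    exact Finset.mem_range.2 hj.2
  have := Finset.card_le_card this
  simpa using this

/-- If every group has an evaluated point, the targets maximise the selection criterion. -/
lemma score_le_of_mem_targets (hS : AllSampled a S) {k : Fin K} (hk : k ∈ targets a δ Z S)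
    {j : Fin K} (hj : ¬ a.group j ⊆ S) : score a δ Z S j ≤ score a δ Z S k := by
  have hun : ¬ (unseenGroups a S).Nonempty := by
    rintro ⟨k, hk⟩
    exact (hS k).ne_empty (Finset.mem_filter.1 hk).2
  unfold targets at hk
  rw [if_neg hun] at hk
  exact (Finset.mem_filter.1 hk).2 j (Finset.mem_filter.2 ⟨Finset.mem_univ j, hj⟩)

/-- A target with an evaluated point is only selected once every group has an evaluated point. -/
lemma allSampled_of_mem_targets (hne : ∀ k, (a.group k).Nonempty) {k : Fin K}
    (hk : k ∈ targets a δ Z S) (hks : (S ∩ a.group k).Nonempty) : AllSampled a S := by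
  intro j
  by_contra hj
  rw [Finset.not_nonempty_iff_eq_empty] at hj
  have hju : j ∈ unseenGroups a S := by
    refine Finset.mem_filter.2 ⟨Finset.mem_filter.2 ⟨Finset.mem_univ j, fun h => ?_⟩, hj⟩
    rw [Finset.inter_eq_right.2 h] at hj
    exact (hne j).ne_empty hj
  unfold targets at hk
  rw [if_pos ⟨j, hju⟩] at hk
  exact hks.ne_empty (Finset.mem_filter.1 hk).2

end Run

/-! ### The radius as a function of the sample size -/

section Radius

variable {K : ℕ} {δ v t : ℝ}

lemma hasDerivAt_logFactor (ht : 1 ≤ t) :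
    HasDerivAt (logFactor K δ) (2 / (Real.log 2 * (Real.logb 2 t + 1) * t)) t := by
  have h0 : 0 ≤ Real.logb 2 t := Real.logb_nonneg one_lt_two ht
  have ht0 : t ≠ 0 := by positivity
  have hlog : HasDerivAt (fun t => Real.logb 2 t) (t⁻¹ / Real.log 2) t :=
    (Real.hasDerivAt_log ht0).div_const _
  have := (((hlog.add_const 1).log (by positivity)).const_mul 2).add_const (Real.log (16 * K / δ))
  refine this.congr_deriv ?_
  have : Real.log 2 ≠ 0 := (Real.log_pos one_lt_two).ne'
  field_simp

/-- The logarithmic derivative of the radius, up to a factor between `1 / 2` and `1`. -/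
lemma exists_deriv_radius_eq (hK : 1 ≤ K) (hδ0 : 0 < δ) (hδ1 : δ < 1) (hv : 0 ≤ v) (ht : 1 ≤ t) :
    ∃ q, radius K δ v t / 2 ≤ q ∧ q ≤ radius K δ v t ∧
      -deriv (fun t => radius K δ v t) t =
        q / t * (1 - 2 / (Real.log 2 * (Real.logb 2 t + 1) * logFactor K δ t)) := by
  have ht0 : 0 < t := by linarith
  have hl := logFactor_pos hK hδ0 hδ1 ht
  have he2 := eta_sq hK hδ0 hδ1 ht
  have he0 : 0 < eta K δ t := by
    refine lt_of_le_of_ne (eta_nonneg _ _ _) fun h => ?_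
    rw [← h, zero_pow two_ne_zero] at he2
    exact (div_pos hl ht0).ne he2
  set e := eta K δ t with he
  have hg0 : 0 < (v + e + e ^ 2) * e ^ 2 := by positivity
  set w := √((v + e + e ^ 2) * e ^ 2) with hw
  have hw0 : 0 < w := Real.sqrt_pos.2 hg0
  have hw2 : w ^ 2 = (v + e + e ^ 2) * e ^ 2 := Real.sq_sqrt hg0.le
  set d := 2 / (Real.log 2 * (Real.logb 2 t + 1) * t) with hd
  have hlt : HasDerivAt (logFactor K δ) d t := hasDerivAt_logFactor ht
  have h1 : HasDerivAt (fun t => logFactor K δ t / t) ((d * t - logFactor K δ t * 1) / t ^ 2) t :=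
    hlt.div (hasDerivAt_id t) ht0.ne'
  have h2 : HasDerivAt (fun t => eta K δ t)
      (((d * t - logFactor K δ t * 1) / t ^ 2) / (2 * e)) t :=
    h1.sqrt (div_pos hl ht0).ne'
  set e' := ((d * t - logFactor K δ t * 1) / t ^ 2) / (2 * e) with he'
  have h3 : HasDerivAt (fun t => radius K δ v t)
      (2 * (2 * e * e') / 3 + 2 * (((e' + 2 * e * e') * e ^ 2 + (v + e + e ^ 2) * (2 * e * e')) /
        (2 * w))) t := by
    have p : HasDerivAt (fun t => eta K δ t ^ 2) (2 * e * e') t :=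
      (h2.pow 2).congr_deriv (by simp [he])
    exact ((p.const_mul 2).div_const 3).add
      (((((h2.const_add v).add p).mul p).sqrt hg0.ne').const_mul 2)
  have hrad : radius K δ v t = 2 * e ^ 2 / 3 + 2 * w := rfl
  have hw' : w = (v + e + e ^ 2) * e ^ 2 / w := by
    rw [← hw2]; field_simp
  -- The witness is `η / 2` times the derivative of the radius with respect to `η`. The bounds on it
  -- hold because every monomial in `η` under the root has degree between 2 and 4.
  refine ⟨2 * e ^ 2 / 3 + (v * e ^ 2 + 3 / 2 * e ^ 3 + 2 * e ^ 4) / w, ?_, ?_, ?_⟩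
  · have : (v + e + e ^ 2) * e ^ 2 / w ≤ (v * e ^ 2 + 3 / 2 * e ^ 3 + 2 * e ^ 4) / w := by
      gcongr
      nlinarith [pow_pos he0 3, pow_pos he0 4]
    rw [hrad]
    nlinarith [sq_nonneg e]
  · have : (v * e ^ 2 + 3 / 2 * e ^ 3 + 2 * e ^ 4) / w ≤ 2 * ((v + e + e ^ 2) * e ^ 2) / w := by
      gcongr
      nlinarith [pow_pos he0 3, pow_pos he0 4, mul_nonneg hv (sq_nonneg e)]
    rw [hrad]
    rw [mul_div_assoc, ← hw'] at this
    linarith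
  · rw [h3.deriv]
    have hd' : 2 / (Real.log 2 * (Real.logb 2 t + 1) * logFactor K δ t) =
        d * t / logFactor K δ t := by
      have h0 : 0 ≤ Real.logb 2 t := Real.logb_nonneg one_lt_two ht
      have : Real.log 2 ≠ 0 := (Real.log_pos one_lt_two).ne'
      rw [hd]
      field_simp
    have hl' : logFactor K δ t = e ^ 2 * t := by rw [he2]; field_simp
    rw [hd', he', hl']
    field_simp
    ring

lemma score_le_div (hK : 1 ≤ K) (hδ0 : 0 < δ) (hδ1 : δ < 1) (hv : 0 ≤ v) (ht : 1 ≤ t) :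
    -deriv (fun t => radius K δ v t) t ≤ radius K δ v t / t := by
  obtain ⟨q, hq1, hq2, hq⟩ := exists_deriv_radius_eq hK hδ0 hδ1 hv ht
  rw [hq]
  have hl := logFactor_pos hK hδ0 hδ1 ht
  have h0 : 0 ≤ Real.logb 2 t := Real.logb_nonneg one_lt_two ht
  have h2 := Real.log_pos one_lt_two
  have hq0 : 0 ≤ q := by
    have : 0 ≤ radius K δ v t := by unfold radius; positivity
    linarith
  have ht0 : 0 < t := by linarith
  calc _ ≤ q / t * 1 := by
        gcongr
        have : 0 ≤ 2 / (Real.log 2 * (Real.logb 2 t + 1) * logFactor K δ t) := by positivity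
        linarith
    _ ≤ _ := by rw [mul_one]; gcongr

/-- The growth of the logarithmic factor must not cancel the decay in `t`. Either alternative in `h`
gives `logFactor ≥ 5 log 2`, hence a correction of at most `7 / 8`; for `K = t = 1` and `δ` near one
the radius would increase. -/
lemma div_le_score (hK : 1 ≤ K) (hδ0 : 0 < δ) (hδ1 : δ < 1) (hv : 0 ≤ v) (ht : 1 ≤ t)
    (h : 2 ≤ K ∨ 2 ≤ t) :
    radius K δ v t / (16 * t) ≤ -deriv (fun t => radius K δ v t) t := by
  obtain ⟨q, hq1, hq2, hq⟩ := exists_deriv_radius_eq hK hδ0 hδ1 hv ht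
  rw [hq]
  have h0 : 0 ≤ Real.logb 2 t := Real.logb_nonneg one_lt_two ht
  have h2 := Real.log_two_gt_d9
  have hr : 0 ≤ radius K δ v t := by unfold radius; positivity
  have ht0 : 0 < t := by linarith
  have hK1 : (1 : ℝ) ≤ K := by exact_mod_cast hK
  have hl : 5 * Real.log 2 ≤ logFactor K δ t := by
    rcases h with h | h
    · refine le_trans ?_ (log_le_logFactor ht)
      rw [← Nat.cast_ofNat (n := 5), ← Real.log_pow]
      apply Real.log_le_log (by norm_num)
      rw [le_div_iff₀ hδ0]
      have : (2 : ℝ) ≤ K := by exact_mod_cast h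
      norm_num
      nlinarith
    · have h1 : 1 ≤ Real.logb 2 t := by
        rw [Real.le_logb_iff_rpow_le one_lt_two ht0]; simpa using h
      have h3 : Real.log 2 ≤ Real.log (Real.logb 2 t + 1) :=
        Real.log_le_log (by norm_num) (by linarith)
      have h4 : 4 * Real.log 2 ≤ Real.log (16 * K / δ) := by
        rw [← Nat.cast_ofNat (n := 4), ← Real.log_pow]
        apply Real.log_le_log (by norm_num)
        rw [le_div_iff₀ hδ0]
        norm_num
        nlinarith
      unfold logFactor
      linarith
  have hκ : 2 / (Real.log 2 * (Real.logb 2 t + 1) * logFactor K δ t) ≤ 7 / 8 := by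
    have h5 : (16 / 7 : ℝ) ≤ Real.log 2 * (Real.logb 2 t + 1) * logFactor K δ t := by
      calc (16 / 7 : ℝ) ≤ Real.log 2 * (0 + 1) * (5 * Real.log 2) := by nlinarith
        _ ≤ _ := by gcongr
    rw [div_le_iff₀ (by linarith)]
    linarith
  calc radius K δ v t / (16 * t) = (radius K δ v t / 2) / t * (1 / 8) := by field_simp; ring
    _ ≤ _ := by
      have : 0 ≤ q := by linarith
      gcongr
      linarith

lemma radius_nonneg : 0 ≤ radius K δ v t := by unfold radius; positivity

/-- The origin of the exponent `2 / 3`: the floor `ε ^ (2/3)` on `u` forces `η ≤ a ε ^ (2/3)`, so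
the term `η ^ 3` under the root, due to estimating the variance, is at most of order `ε ^ 2`, like
`v η ^ 2`. -/
lemma radius_le_of_eta_sq_le {ε a u vh : ℝ} (hε0 : 0 < ε) (hε1 : ε < 1) (ha0 : 0 < a) (ha1 : a ≤ 1)
    (hu : max v (ε ^ (2 / 3 : ℝ)) ≤ u) (hvh : vh ≤ v + eta K δ t)
    (h : eta K δ t ^ 2 * u ≤ a ^ 2 * ε ^ 2) : radius K δ vh t ≤ 5 * a * ε := by
  set y := ε ^ (1 / 3 : ℝ) with hy
  have hy0 : 0 < y := Real.rpow_pos_of_pos hε0 _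
  have hy1 : y ≤ 1 := Real.rpow_le_one hε0.le hε1.le (by norm_num)
  have hy2 : ε ^ (2 / 3 : ℝ) = y ^ 2 := by
    rw [hy, ← Real.rpow_natCast, ← Real.rpow_mul hε0.le]; norm_num
  have hy3 : ε = y ^ 3 := by
    rw [hy, ← Real.rpow_natCast, ← Real.rpow_mul hε0.le]; norm_num
  rw [hy2] at hu
  have hvu : v ≤ u := (le_max_left _ _).trans hu
  have hyu : y ^ 2 ≤ u := (le_max_right _ _).trans hu
  set e := eta K δ t with he
  have he0 : 0 ≤ e := eta_nonneg _ _ _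
  have e1 : e ^ 2 ≤ (a * y ^ 2) ^ 2 := by
    have h1 : e ^ 2 * y ^ 2 ≤ (a * y ^ 2) ^ 2 * y ^ 2 := by
      calc e ^ 2 * y ^ 2 ≤ e ^ 2 * u := by gcongr
        _ ≤ a ^ 2 * ε ^ 2 := h
        _ = _ := by rw [hy3]; ring
    exact le_of_mul_le_mul_right h1 (by positivity)
  have e2 : e ≤ a * y ^ 2 := (sq_le_sq₀ he0 (by positivity)).1 e1
  have hy4 : y ^ 4 ≤ y ^ 3 := pow_le_pow_of_le_one hy0.le hy1 (by norm_num)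
  have hy8 : y ^ 8 ≤ y ^ 6 := pow_le_pow_of_le_one hy0.le hy1 (by norm_num)
  have ha2 : a ^ 2 ≤ a := by nlinarith
  have ha3 : a ^ 3 ≤ a ^ 2 := pow_le_pow_of_le_one ha0.le ha1 (by norm_num)
  have ha4 : a ^ 4 ≤ a ^ 2 := pow_le_pow_of_le_one ha0.le ha1 (by norm_num)
  have e3 : e ^ 3 ≤ a ^ 2 * y ^ 6 := by
    calc e ^ 3 ≤ (a * y ^ 2) ^ 3 := by gcongr
      _ = a ^ 3 * y ^ 6 := by ring
      _ ≤ _ := by gcongr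
  have e4 : e ^ 4 ≤ a ^ 2 * y ^ 6 := by
    calc e ^ 4 ≤ (a * y ^ 2) ^ 4 := by gcongr
      _ = a ^ 4 * y ^ 8 := by ring
      _ ≤ _ := by gcongr
  have e5 : v * e ^ 2 ≤ a ^ 2 * y ^ 6 := by
    calc v * e ^ 2 ≤ u * e ^ 2 := by gcongr
      _ = e ^ 2 * u := by ring
      _ ≤ a ^ 2 * ε ^ 2 := h
      _ = _ := by rw [hy3]; ring
  have hg : (vh + e + e ^ 2) * e ^ 2 ≤ (2 * a * ε) ^ 2 := by
    calc (vh + e + e ^ 2) * e ^ 2 ≤ (v + e + e + e ^ 2) * e ^ 2 := by gcongr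
      _ = v * e ^ 2 + 2 * e ^ 3 + e ^ 4 := by ring
      _ ≤ 4 * (a ^ 2 * y ^ 6) := by linarith
      _ = _ := by rw [hy3]; ring
  have hs : √((vh + e + e ^ 2) * e ^ 2) ≤ 2 * a * ε := Real.sqrt_le_iff.2 ⟨by positivity, hg⟩
  have hlin : e ^ 2 ≤ a * ε := by
    calc e ^ 2 ≤ (a * y ^ 2) ^ 2 := e1
      _ = a ^ 2 * y ^ 4 := by ring
      _ ≤ a * y ^ 3 := by gcongr
      _ = _ := by rw [hy3]
  unfold radius
  rw [← he]
  have : 0 < a * ε := by positivity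
  linarith

/-- For small `ε` the logarithmic factor is of the order of that in the size of the dataset. -/
lemma logFactor_le {c ε N : ℝ} (hK : 1 ≤ K) (hδ0 : 0 < δ) (hδ1 : δ < 1) (hc : 0 < c) (hε0 : 0 < ε)
    (hx : Real.exp 1 ≤ Real.log (1 / ε)) (hxc : Real.log c ≤ Real.log (1 / ε)) (ht : 1 ≤ t)
    (htN : t ≤ N)
    (hN : N ≤ c * (ε⁻¹ ^ 2 * (Real.log (1 / δ) + Real.log (Real.log (1 / ε))))) :
    logFactor K δ t ≤
      25 * (Real.log (K + 1) * (Real.log (1 / δ) + Real.log (Real.log (1 / ε)))) := by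
  set x := Real.log (1 / ε) with hxdef
  set L := Real.log (1 / δ) + Real.log x with hL
  have hd0 : 0 < Real.log (1 / δ) := Real.log_pos ((one_lt_div hδ0).2 hδ1)
  have hx1 : 1 ≤ x := by linarith [Real.add_one_le_exp 1]
  have hlx : 1 ≤ Real.log x := by
    rw [← Real.log_exp 1]; exact Real.log_le_log (Real.exp_pos 1) hx
  have hL1 : 1 ≤ L := by linarith
  have hlL : Real.log L ≤ L - 1 := Real.log_le_sub_one_of_pos (by linarith)
  have hl2 := Real.log_two_gt_d9
  have hl2' := Real.log_two_lt_d9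
  -- The constant `c` enters through `log c ≤ x` only, which keeps the final factor 25 universal.
  have hlogt : Real.log t ≤ 3 * x + L := by
    calc Real.log t ≤ Real.log (c * (ε⁻¹ ^ 2 * L)) :=
          Real.log_le_log (by linarith) (htN.trans hN)
      _ = Real.log c + (2 * x + Real.log L) := by
          rw [Real.log_mul hc.ne' (by positivity), Real.log_mul (by positivity) (by positivity),
            Real.log_pow, hxdef, one_div]
          norm_num
      _ ≤ _ := by linarith
  have hlogb : Real.logb 2 t + 1 ≤ 8 * (x * L) := by
    have : Real.logb 2 t ≤ 1.5 * (3 * x + L) := by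
      rw [Real.logb, div_le_iff₀ (by linarith)]
      nlinarith
    nlinarith
  have hb0 : 0 ≤ Real.logb 2 t := Real.logb_nonneg one_lt_two ht
  have h1 : Real.log (Real.logb 2 t + 1) ≤ 3 * Real.log 2 + (Real.log x + Real.log L) := by
    calc _ ≤ Real.log (8 * (x * L)) := Real.log_le_log (by linarith) hlogb
      _ = _ := by
        rw [Real.log_mul (by norm_num) (by positivity), Real.log_mul (by positivity) (by positivity),
          show (8 : ℝ) = 2 ^ 3 by norm_num, Real.log_pow]
        norm_num
  have hK1 : (1 : ℝ) ≤ K := by exact_mod_cast hK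
  have h2 : Real.log (16 * K / δ) = 4 * Real.log 2 + Real.log K + Real.log (1 / δ) := by
    rw [show 16 * (K : ℝ) / δ = 2 ^ 4 * K * (1 / δ) by ring,
      Real.log_mul (by positivity) (by positivity), Real.log_mul (by positivity) (by positivity),
      Real.log_pow]
    norm_num
  have hq : Real.log K ≤ Real.log (K + 1) := Real.log_le_log (by linarith) (by linarith)
  have hq2 : Real.log 2 ≤ Real.log (K + 1) := Real.log_le_log (by norm_num) (by linarith)
  unfold logFactor
  rw [h2]
  nlinarith

end Radius

lemma empVar_nonneg {n : ℕ} (Z : Fin n → ℝ) (S : Finset (Fin n)) : 0 ≤ empVar Z S := by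
  unfold empVar; positivity

/-! ### The number of evaluated points -/

section Efficiency

variable {n K : ℕ} {a : Input n K} {ε δ L : ℝ} {Z : Fin n → ℝ} {v : Fin K → ℝ}

/-- A group with sufficiently many evaluated points has a small radius. -/
lemma radius_le_of_le_card (hK : 1 ≤ K) (hε0 : 0 < ε) (hε1 : ε < 1) (hδ0 : 0 < δ) (hδ1 : δ < 1)
    (hn : 2500 * L ≤ n * ε ^ 2)
    (hlog : ∀ t : ℝ, 1 ≤ t → t ≤ n → logFactor K δ t ≤ 25 * (Real.log (K + 1) * L))
    {T : Finset (Fin n)} {v₀ : ℝ} (hT : T.Nonempty) (hvar : empVar Z T ≤ v₀ + eta K δ T.card)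
    {θ b : ℝ} (hb0 : 0 < b) (hb1 : b ≤ 1) (hθb : 1 ≤ 100 * θ * b ^ 2)
    (hcard : θ * (n * (Real.log (K + 1) * max v₀ (ε ^ (2 / 3 : ℝ)))) ≤ T.card) :
    radius K δ (empVar Z T) T.card ≤ 5 * b * ε := by
  have hT1 : (1 : ℝ) ≤ T.card := Nat.one_le_cast.2 hT.card_pos
  have hTn : (T.card : ℝ) ≤ n := by
    have := Finset.card_le_univ T
    rw [Fintype.card_fin] at this
    exact_mod_cast this
  refine radius_le_of_eta_sq_le (u := max v₀ (ε ^ (2 / 3 : ℝ))) hε0 hε1 hb0 hb1 le_rfl hvar ?_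
  set u := max v₀ (ε ^ (2 / 3 : ℝ)) with hu
  have hu0 : 0 < u := lt_max_of_lt_right (Real.rpow_pos_of_pos hε0 _)
  set q := Real.log (K + 1) with hq
  have hq0 : 0 < q := Real.log_pos (by
    have : (1 : ℝ) ≤ K := by exact_mod_cast hK
    linarith)
  rw [eta_sq hK hδ0 hδ1 hT1, div_mul_eq_mul_div, div_le_iff₀ (by linarith)]
  calc logFactor K δ T.card * u ≤ 25 * (q * L) * u := by
        gcongr
        exact hlog _ hT1 hTn
    _ = (25 * L) * (q * u) := by ring
    _ ≤ (n * ε ^ 2 / 100) * (q * u) := by gcongr; linarith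
    _ ≤ (n * ε ^ 2 / 100) * (q * u) * (100 * θ * b ^ 2) := le_mul_of_one_le_right (by positivity) hθb
    _ = b ^ 2 * ε ^ 2 * (θ * (n * (q * u))) := by ring
    _ ≤ b ^ 2 * ε ^ 2 * T.card := by gcongr

/-- When a target group has a small radius, the total radius is controlled by its score. -/
lemma totalRadius_le_of_mem_targets (ha : a.IsAdmissible) (hε0 : 0 < ε) (hε1 : ε < 1)
    (hδ0 : 0 < δ) (hδ1 : δ < 1) (hn : 2500 * L ≤ n * ε ^ 2)
    (hlog : ∀ t : ℝ, 1 ≤ t → t ≤ n → logFactor K δ t ≤ 25 * (Real.log (K + 1) * L))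
    (hw0 : ∀ k, 0 ≤ a.weight k) (hw1 : ∑ k, a.weight k ≤ 1) {S : Finset (Fin n)}
    (hvar : ∀ k, (S ∩ a.group k).Nonempty →
      empVar Z (S ∩ a.group k) ≤ v k + eta K δ (S ∩ a.group k).card)
    (hbenign : ∀ k, n * (Real.log (K + 1) * max (v k) (ε ^ (2 / 3 : ℝ))) ≤ (a.group k).card)
    (hall : AllSampled a S) {k₀ : Fin K} (htar : k₀ ∈ targets a δ Z S)
    (hN2 : (2 : ℝ) ≤ (S ∩ a.group k₀).card) (hrad : groupRadius a δ Z S k₀ ≤ ε / 2) :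
    0 ≤ score a δ Z S k₀ ∧ totalRadius a δ Z S ≤ ε / 2 + 16 * (score a δ Z S k₀ * S.card) := by
  have hK : ∀ k : Fin K, 1 ≤ K := fun k => (Nat.zero_le _).trans_lt k.2
  set σ := score a δ Z S k₀ with hσ
  have hcard1 : ∀ j, (1 : ℝ) ≤ (S ∩ a.group j).card := fun j => Nat.one_le_cast.2 (hall j).card_pos
  have hlow : ∀ j, (2 ≤ K ∨ (2 : ℝ) ≤ (S ∩ a.group j).card) →
      a.weight j * groupRadius a δ Z S j ≤ 16 * (score a δ Z S j * (S ∩ a.group j).card) := by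
    intro j hj
    have h1 := div_le_score (hK j) hδ0 hδ1 (empVar_nonneg Z (S ∩ a.group j)) (hcard1 j) hj
    rw [div_le_iff₀ (by linarith [hcard1 j])] at h1
    calc _ ≤ a.weight j * (-deriv (fun t => radius K δ (empVar Z (S ∩ a.group j)) t)
          (S ∩ a.group j).card * (16 * (S ∩ a.group j).card)) :=
          mul_le_mul_of_nonneg_left h1 (hw0 j)
      _ = _ := by unfold score; ring
  have hσ0 : 0 ≤ σ := by
    have h1 := hlow k₀ (Or.inr (hN2))
    have h2 : 0 ≤ a.weight k₀ * groupRadius a δ Z S k₀ := mul_nonneg (hw0 _) radius_nonneg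
    by_contra hneg
    push Not at hneg
    have h4 : σ * (S ∩ a.group k₀).card < 0 := mul_neg_of_neg_of_pos hneg (by linarith)
    linarith
  have hterm : ∀ j, a.weight j * groupRadius a δ Z S j ≤
      a.weight j * (ε / 2) + 16 * (σ * (S ∩ a.group j).card) := by
    intro j
    have hσj : 0 ≤ 16 * (σ * (S ∩ a.group j).card) := by positivity
    -- Exhausted groups have radius at most `ε / 2` by benignity, the target by `hrad`. Any other
    -- group is open, so its score is at most `σ`, and its existence forces `2 ≤ K`, as
    -- `div_le_score` requires.
    by_cases hsub : a.group j ⊆ S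
    · have hint : S ∩ a.group j = a.group j := Finset.inter_eq_right.2 hsub
      have := radius_le_of_le_card (hK j) hε0 hε1 hδ0 hδ1 hn hlog (hall j)
        (hvar j (hall j)) (θ := 1) (b := 1 / 10) (by norm_num)
        (by norm_num) (by norm_num) (by rw [one_mul, hint]; exact hbenign j)
      have h1 : groupRadius a δ Z S j ≤ ε / 2 := this.trans (le_of_eq (by ring))
      linarith [mul_le_mul_of_nonneg_left h1 (hw0 j)]
    · rcases eq_or_ne j k₀ with rfl | hj
      · have h1 : groupRadius a δ Z S j ≤ ε / 2 := hrad
        linarith [mul_le_mul_of_nonneg_left h1 (hw0 j)]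
      · have hK2 : 2 ≤ K := by
          by_contra hK'
          exact hj (Fin.ext (by omega))
        have h1 := hlow j (Or.inl hK2)
        have h2 := score_le_of_mem_targets hall htar hsub
        have h3 : score a δ Z S j * (S ∩ a.group j).card ≤ σ * (S ∩ a.group j).card :=
          mul_le_mul_of_nonneg_right h2 (Nat.cast_nonneg _)
        have h4 : 0 ≤ a.weight j * (ε / 2) := mul_nonneg (hw0 j) (by linarith)
        linarith
  have hsumS : (S.card : ℝ) = ∑ j, ((S ∩ a.group j).card : ℝ) := by
    exact_mod_cast card_eq_sum_card_inter ha S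
  refine ⟨hσ0, ?_⟩
  calc totalRadius a δ Z S ≤ ∑ j, (a.weight j * (ε / 2) + 16 * (σ * (S ∩ a.group j).card)) :=
        Finset.sum_le_sum fun j _ => hterm j
    _ = (∑ j, a.weight j) * (ε / 2) + 16 * (σ * S.card) := by
        rw [Finset.sum_add_distrib, ← Finset.sum_mul, ← Finset.mul_sum, ← Finset.mul_sum, hsumS]
    _ ≤ 1 * (ε / 2) + 16 * (σ * S.card) := by gcongr
    _ = _ := by rw [one_mul]

/-- As long as the empirical variances are not too large, the number of evaluated points is of the
order of the number that suffices to make all radii small. -/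
lemma card_evaluated_le (ha : a.IsAdmissible) (hε0 : 0 < ε) (hε1 : ε < 1)
    (hδ0 : 0 < δ) (hδ1 : δ < 1) (hn : 2500 * L ≤ n * ε ^ 2)
    (hlog : ∀ t : ℝ, 1 ≤ t → t ≤ n → logFactor K δ t ≤ 25 * (Real.log (K + 1) * L))
    (hw0 : ∀ k, 0 ≤ a.weight k) (hw1 : ∑ k, a.weight k ≤ 1)
    (hvar : ∀ t k, (evaluated a ε δ Z t ∩ a.group k).Nonempty →
      empVar Z (evaluated a ε δ Z t ∩ a.group k) ≤
        v k + eta K δ (evaluated a ε δ Z t ∩ a.group k).card)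
    (hbenign : ∀ k, n * (Real.log (K + 1) * max (v k) (ε ^ (2 / 3 : ℝ))) ≤ (a.group k).card)
    (hone : 1 ≤ n * (Real.log (K + 1) * ε ^ (2 / 3 : ℝ))) {c : ℝ}
    (hm : (a.m : ℝ) ≤ c * ∑ k, n * (Real.log (K + 1) * max (v k) (ε ^ (2 / 3 : ℝ)))) (t : ℕ) :
    ((evaluated a ε δ Z t).card : ℝ) ≤
      (2 * c + 16384) * ∑ k, n * (Real.log (K + 1) * max (v k) (ε ^ (2 / 3 : ℝ))) := by
  classical
  set h : Fin K → ℝ := fun k => n * (Real.log (K + 1) * max (v k) (ε ^ (2 / 3 : ℝ))) with hh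
  have hlog0 : 0 ≤ Real.log ((K : ℝ) + 1) := Real.log_nonneg (by
    linarith [Nat.cast_nonneg (α := ℝ) K])
  have hh1 : ∀ k, 1 ≤ h k := fun k => hone.trans (by
    simp only [hh]; gcongr; exact le_max_right _ _)
  have hgne : ∀ k, (a.group k).Nonempty := fun k => by
    rw [← Finset.card_pos]
    have : (0 : ℝ) < (a.group k).card := by linarith [hbenign k, hh1 k]
    exact_mod_cast this
  by_contra hlt
  push Not at hlt
  set E : ℕ → Finset (Fin n) := evaluated a ε δ Z with hE
  set p : Fin K → ℝ := fun k => (E t ∩ a.group k).card - ((a.warmStart ∩ a.group k).card : ℝ)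
    with hp
  -- The warm start and the groups outside `Big` account for at most `(c + 8192) ∑ h k`, less than
  -- half of the evaluated points.
  set Big : Finset (Fin K) := Finset.univ.filter fun k => 8192 * h k ≤ p k with hBig
  have hbig_le : ∀ k ∈ Big, 8192 * h k ≤ p k := fun k hk => (Finset.mem_filter.1 hk).2
  have hsumE : ((E t).card : ℝ) = ∑ k, ((E t ∩ a.group k).card : ℝ) := by
    exact_mod_cast card_eq_sum_card_inter ha (E t)
  have hsumW : (a.warmStart.card : ℝ) = ∑ k, ((a.warmStart ∩ a.group k).card : ℝ) := by
    exact_mod_cast card_eq_sum_card_inter ha a.warmStart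
  have hW : (a.warmStart.card : ℝ) ≤ c * ∑ k, h k :=
    le_trans (by exact_mod_cast card_warmStart_le) hm
  have hsplit : ((E t).card : ℝ) = a.warmStart.card + ∑ k, p k := by
    rw [hsumE, hsumW, ← Finset.sum_add_distrib]
    exact Finset.sum_congr rfl fun k _ => by simp only [hp]; ring
  have hsmall : ∑ k, p k ≤ ∑ k ∈ Big, p k + 8192 * ∑ k, h k := by
    rw [← Finset.sum_filter_add_sum_filter_not Finset.univ (fun k => 8192 * h k ≤ p k) p]
    refine add_le_add le_rfl ?_
    rw [Finset.mul_sum]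
    calc _ ≤ ∑ k ∈ Finset.univ.filter (fun k => ¬ 8192 * h k ≤ p k), 8192 * h k :=
          Finset.sum_le_sum fun k hk => (not_le.1 (Finset.mem_filter.1 hk).2).le
      _ ≤ _ := Finset.sum_le_sum_of_subset_of_nonneg (Finset.filter_subset _ _)
          fun k _ _ => by linarith [hh1 k]
  have hhalf : ((E t).card : ℝ) ≤ 2 * ∑ k ∈ Big, p k := by
    linarith
  have hpE : ∀ k, p k ≤ (E t ∩ a.group k).card := fun k => by
    simp only [hp]; linarith [Nat.cast_nonneg (α := ℝ) (a.warmStart ∩ a.group k).card]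
  have hpick : ∀ k ∈ Big, ∃ s < t, ¬ Stops a ε δ Z (E s) ∧ k ∈ targets a δ Z (E s) ∧
      (E s ∩ a.group k).card + 1 = (E t ∩ a.group k).card := fun k hk => by
    refine exists_last_pick ha ?_
    have h1 := hbig_le k hk
    have h2 := hh1 k
    have : ((a.warmStart ∩ a.group k).card : ℝ) < (E t ∩ a.group k).card := by
      simp only [hp] at h1; linarith
    exact_mod_cast this
  choose! s hst hns htar hcard using hpick
  have hcardR : ∀ k ∈ Big, ((E t ∩ a.group k).card : ℝ) = (E (s k) ∩ a.group k).card + 1 :=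
    fun k hk => by exact_mod_cast (hcard k hk).symm
  -- Halving 8192 absorbs the one point by which the last selection precedes the final count, as `1
  -- ≤ h k`.
  have hN : ∀ k ∈ Big, 4096 * h k ≤ (E (s k) ∩ a.group k).card := fun k hk => by
    linarith [hbig_le k hk, hh1 k, hpE k, hcardR k hk]
  have hN2 : ∀ k ∈ Big, (2 : ℝ) ≤ (E (s k) ∩ a.group k).card := fun k hk => by
    linarith [hN k hk, hh1 k]
  have hne : ∀ k ∈ Big, (E (s k) ∩ a.group k).Nonempty := fun k hk => by
    rw [← Finset.card_pos]
    have : (0 : ℝ) < (E (s k) ∩ a.group k).card := by linarith [hN2 k hk]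
    exact_mod_cast this
  have hK : ∀ k : Fin K, 1 ≤ K := fun k => (Nat.zero_le _).trans_lt k.2
  have hrad : ∀ k ∈ Big, groupRadius a δ Z (E (s k)) k ≤ ε / 128 := fun k hk => by
    have := radius_le_of_le_card (hK k) hε0 hε1 hδ0 hδ1 hn hlog (hne k hk)
      (hvar (s k) k (hne k hk)) (θ := 4096) (b := 1 / 640) (by norm_num)
      (by norm_num) (by norm_num) (hN k hk)
    refine this.trans (le_of_eq (by ring))
  have hscore : ∀ k ∈ Big, score a δ Z (E (s k)) k * (E (s k) ∩ a.group k).card ≤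
      a.weight k * (ε / 128) := fun k hk => by
    have h1 := score_le_div (hK k) hδ0 hδ1 (empVar_nonneg Z (E (s k) ∩ a.group k))
      (t := (E (s k) ∩ a.group k).card) (by linarith [hN2 k hk])
    have h2 : (0 : ℝ) < (E (s k) ∩ a.group k).card := by linarith [hN2 k hk]
    rw [le_div_iff₀ h2] at h1
    calc _ = a.weight k * (-deriv (fun t => radius K δ (empVar Z (E (s k) ∩ a.group k)) t)
          (E (s k) ∩ a.group k).card * (E (s k) ∩ a.group k).card) := by
          unfold score; ring
      _ ≤ a.weight k * groupRadius a δ Z (E (s k)) k :=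
          mul_le_mul_of_nonneg_left h1 (hw0 k)
      _ ≤ _ := mul_le_mul_of_nonneg_left (hrad k hk) (hw0 k)
  have hBne : Big.Nonempty := by
    rw [Finset.nonempty_iff_ne_empty]
    intro hB
    rw [hB] at hhalf
    simp only [Finset.sum_empty, mul_zero] at hhalf
    have h1 : (a.warmStart.card : ℝ) + ∑ k, p k ≤ 0 := by linarith
    have h2 : ∑ k, h k = 0 ∨ 0 < ∑ k, h k := by
      rcases (Finset.sum_nonneg fun k (_ : k ∈ Finset.univ) => (zero_le_one.trans (hh1 k))).eq_or_lt with h | h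
      · exact Or.inl h.symm
      · exact Or.inr h
    have h3 : (0 : ℝ) ≤ a.warmStart.card := Nat.cast_nonneg _
    rcases h2 with h2 | h2
    · rw [h2] at hlt; linarith
    · have : 0 ≤ c * ∑ k, h k := h3.trans hW
      linarith
  -- The groups in `Big` were last selected at different times; the least of their scores can
  -- replace each of them in `hscore`, and summing over `Big` bounds it.
  obtain ⟨k₀, hk₀, hmin⟩ := Finset.exists_min_image Big (fun k => score a δ Z (E (s k)) k) hBne
  set S := E (s k₀) with hS
  set σ := score a δ Z S k₀ with hσ
  have hall : AllSampled a S := allSampled_of_mem_targets hgne (htar k₀ hk₀) (hne k₀ hk₀)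
  obtain ⟨hσ0, htot⟩ := totalRadius_le_of_mem_targets ha hε0 hε1 hδ0 hδ1 hn hlog hw0 hw1
    (hvar (s k₀)) hbenign hall (htar k₀ hk₀) (hN2 k₀ hk₀) ((hrad k₀ hk₀).trans (by linarith))
  have hSE : (S.card : ℝ) ≤ (E t).card := by
    exact_mod_cast Finset.card_le_card (evaluated_mono (hst k₀ hk₀).le)
  have hEs : ((E t).card : ℝ) ≤ 4 * ∑ k ∈ Big, ((E (s k) ∩ a.group k).card : ℝ) := by
    have : ∑ k ∈ Big, p k ≤ ∑ k ∈ Big, 2 * ((E (s k) ∩ a.group k).card : ℝ) :=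
      Finset.sum_le_sum fun k hk => by linarith [hpE k, hcardR k hk, hN2 k hk]
    rw [← Finset.mul_sum] at this
    linarith
  have hσsum : σ * ∑ k ∈ Big, ((E (s k) ∩ a.group k).card : ℝ) ≤ ε / 128 := by
    rw [Finset.mul_sum]
    calc _ ≤ ∑ k ∈ Big, a.weight k * (ε / 128) := Finset.sum_le_sum fun k hk =>
          (mul_le_mul_of_nonneg_right (hmin k hk) (Nat.cast_nonneg _)).trans (hscore k hk)
      _ ≤ ∑ k, a.weight k * (ε / 128) := Finset.sum_le_sum_of_subset_of_nonneg
          (Finset.subset_univ _) fun k _ _ => mul_nonneg (hw0 k) (by positivity)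
      _ = (∑ k, a.weight k) * (ε / 128) := by rw [Finset.sum_mul]
      _ ≤ 1 * (ε / 128) := by gcongr
      _ = _ := one_mul _
  apply hns k₀ hk₀
  refine Or.inl ⟨hall, ?_⟩
  -- The second term is at most `16 * 4 * ε / 128 = ε / 2`.
  calc totalRadius a δ Z S ≤ ε / 2 + 16 * (σ * S.card) := htot
    _ ≤ ε / 2 + 16 * (σ * (4 * ∑ k ∈ Big, ((E (s k) ∩ a.group k).card : ℝ))) := by
        gcongr
        exact hSE.trans hEs
    _ ≤ ε := by linarith

end Efficiency

/-! ### Certification -/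

/-- If the confidence statements hold in all groups, the overall interval contains the risk. -/
lemma abs_sub_estimate_le {n K : ℕ} {a : Input n K} {δ : ℝ} {Z : Fin n → ℝ} {S : Finset (Fin n)}
    {r v : Fin K → ℝ} (hw : ∀ k, 0 ≤ a.weight k)
    (hacc : ∀ k, IsAccurate K δ Z (r k) (v k) (S ∩ a.group k)) :
    |∑ k, a.weight k * r k - estimate a Z S| ≤ totalRadius a δ Z S := by
  unfold estimate totalRadius
  rw [← Finset.sum_sub_distrib]
  refine (Finset.abs_sum_le_sum_abs _ _).trans (Finset.sum_le_sum fun k _ => ?_)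
  rw [← mul_sub, abs_mul, abs_of_nonneg (hw k), abs_sub_comm]
  exact mul_le_mul_of_nonneg_left (hacc k).1 (hw k)

section Task

variable {𝒳 𝒴 : Type*} [MeasurableSpace 𝒳] [MeasurableSpace 𝒴]
  {P : Measure (𝒳 × 𝒴)} [IsProbabilityMeasure P] {f : Kernel 𝒳 𝒴} [IsMarkovKernel f]
  {ℓ : 𝒴 → 𝒴 → ℝ} {n K : ℕ} {A : Fin K → Set (𝒳 × 𝒴)}

/-- Cer-Eval is certified for `n'` if it evaluates fewer than `n'` points whenever the empirical
variances in the groups are not too large. -/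
lemma isCertified_cerEval (hℓ : Measurable fun p : 𝒴 × 𝒴 => ℓ p.1 p.2)
    (hℓb : ∀ y y', 0 ≤ ℓ y y' ∧ ℓ y y' ≤ 1) (hK : 1 ≤ K) (hA : ∀ k, MeasurableSet (A k))
    (hdisj : Pairwise fun j k => Disjoint (A j) (A k)) (hcov : ∀ᵐ z ∂P, ∃ k, z ∈ A k)
    {ε δ : ℝ} (hδ0 : 0 < δ) (hδ1 : δ < 1) {m n' : ℕ} (G : Fin K → Finset (Fin n))
    {pickGroup : Finset (Fin K) → Fin K} {pickPoint : Finset (Fin n) → Fin n}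
    (hpG : ∀ s : Finset (Fin K), s.Nonempty → pickGroup s ∈ s)
    (hpP : ∀ s : Finset (Fin n), s.Nonempty → pickPoint s ∈ s)
    (hn' : ∀ (a : Input n K) (Z : Fin n → ℝ),
      a = ⟨m, G, fun k => P.real (A k), pickGroup, pickPoint⟩ → a.IsAdmissible →
      (∀ t k, (evaluated a ε δ Z t ∩ a.group k).Nonempty →
        empVar Z (evaluated a ε δ Z t ∩ a.group k) ≤
          condVar P f ℓ (A k) + eta K δ (evaluated a ε δ Z t ∩ a.group k).card) →
      (evaluated a ε δ Z n).card < n') :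
    IsCertified (dataLaw P f A G) (risk P f ℓ) (cerEval P ℓ A m pickGroup pickPoint) n' ε δ := by
  unfold IsCertified
  -- Conditioning on a split of probability zero gives the zero measure.
  by_cases h0 : dataLaw P f A G = 0
  · simp [h0]
  obtain ⟨hprob, hG, hex, hGd, hind, hmom⟩ := dataLaw_spec hℓ hA hdisj hcov G h0
  set Q := dataLaw P f A G with hQ
  let a : Input n K := ⟨m, G, fun k => P.real (A k), pickGroup, pickPoint⟩
  have ha : a.IsAdmissible := ⟨hpG, hpP, hGd, hex⟩
  let Z : Fin n → (Fin n → (𝒳 × 𝒴) × 𝒴) → ℝ := fun i ω => lossAt ℓ (ω i)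
  let bad : Fin K → Set (Fin n → (𝒳 × 𝒴) × 𝒴) := fun k =>
    {ω | ∃ j, (a.chain k j).Nonempty ∧
      ¬ IsAccurate K δ (fun i => Z i ω) (condRisk P f ℓ (A k)) (condVar P f ℓ (A k)) (a.chain k j)}
  have hbad : ∀ k, Q (bad k) ≤ ENNReal.ofReal (δ / K) := fun k =>
    measure_exists_not_isAccurate_le hK hδ0 hδ1 hind
      (fun i => (measurable_lossAt hℓ).comp (measurable_pi_apply i)) (fun i ω => hℓb _ _)
      (fun i hi => (hmom k i hi).1) (fun i hi => (hmom k i hi).2) (Input.chain_mono k)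
      (ha.chain_subset k)
  have hunion : Q (⋃ k, bad k) ≤ ENNReal.ofReal δ := by
    have hK0 : (0 : ℝ) < K := by exact_mod_cast hK
    calc Q (⋃ k, bad k) ≤ ∑ k, Q (bad k) := measure_iUnion_fintype_le _ _
      _ ≤ ∑ _k : Fin K, ENNReal.ofReal (δ / K) := Finset.sum_le_sum fun k _ => hbad k
      _ = ENNReal.ofReal (K * (δ / K)) := by
          rw [ENNReal.ofReal_mul (Nat.cast_nonneg _)]; simp
      _ = ENNReal.ofReal δ := by rw [mul_div_cancel₀ _ hK0.ne']
  -- The same bad event covers both kinds of failure, so `δ` is spent only once.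
  refine (measure_mono_ae ?_).trans hunion
  filter_upwards [hG] with ω hω hev
  by_contra hgood
  have hacc : ∀ t k, (evaluated a ε δ (fun i => Z i ω) t ∩ a.group k).Nonempty →
      IsAccurate K δ (fun i => Z i ω) (condRisk P f ℓ (A k)) (condVar P f ℓ (A k))
        (evaluated a ε δ (fun i => Z i ω) t ∩ a.group k) := by
    intro t k hne
    obtain ⟨j, hj⟩ := evaluated_inter_group (ε := ε) (δ := δ) (Z := fun i => Z i ω) ha t k
    rw [hj] at hne ⊢
    by_contra hna
    exact hgood (Set.mem_iUnion.2 ⟨k, j, hne, hna⟩)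
  have hrun : cerEval P ℓ A m pickGroup pickPoint ε δ ω = run a ε δ fun i => Z i ω := by
    unfold cerEval
    rw [hω]
  change n' ≤ _ ∨ _ at hev
  rw [hrun] at hev
  rcases hev with hev | ⟨I, ⟨t, hall, rfl⟩, hI⟩
  · exact absurd hev (not_le.2 (hn' a _ rfl ha fun t k hne => (hacc t k hne).2))
  · apply hI
    rw [risk_eq_sum hℓ hℓb hA hdisj hcov]
    exact abs_sub_estimate_le (a := a) (fun k => measureReal_nonneg) fun k => hacc t k (hall k)

end Task

end CerEval

/-! ### Choice of constants; small and large `ε` -/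

theorem theorem2 :
    ∃ c₀ : ℝ, 0 < c₀ ∧ ∀ c₁ c₂ c₃ : ℝ, c₀ ≤ c₁ → c₁ ≤ c₂ → 0 ≤ c₃ → ∃ C : ℝ, 0 < C ∧
      ∀ (𝒳 𝒴 : Type*) [MeasurableSpace 𝒳] [MeasurableSpace 𝒴]
        (P : Measure (𝒳 × 𝒴)) [IsProbabilityMeasure P] (f : Kernel 𝒳 𝒴) [IsMarkovKernel f]
        (ℓ : 𝒴 → 𝒴 → ℝ), Measurable (fun p : 𝒴 × 𝒴 => ℓ p.1 p.2) →
        (∀ y y', 0 ≤ ℓ y y' ∧ ℓ y y' ≤ 1) →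
      ∀ (K : ℕ) (A : Fin K → Set (𝒳 × 𝒴)), (∀ k, MeasurableSet (A k)) →
        Pairwise (fun j k => Disjoint (A j) (A k)) → (∀ᵐ z ∂P, ∃ k, z ∈ A k) →
      ∀ (ε δ : ℝ), 0 < ε → ε < 1 → 0 < δ → δ < 1 →
      ∀ (n m : ℕ),
        c₁ * (ε⁻¹ ^ 2 * (Real.log (1 / δ) + Real.log (Real.log (1 / ε)))) ≤ n →
        n ≤ c₂ * (ε⁻¹ ^ 2 * (Real.log (1 / δ) + Real.log (Real.log (1 / ε)))) →
        (m : ℝ) ≤ c₃ * n * (Real.log (K + 1) *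
          ∑ k, max (CerEval.condVar P f ℓ (A k)) (ε ^ (2 / 3 : ℝ))) →
      ∃ n' : ℕ,
        (n' : ℝ) / n ≤ C * (Real.log (K + 1) *
          ∑ k, max (CerEval.condVar P f ℓ (A k)) (ε ^ (2 / 3 : ℝ))) ∧
        ∀ G : Fin K → Finset (Fin n),
          CerEval.IsBenign (fun k => CerEval.condVar P f ℓ (A k)) ε G →
        ∀ (pickGroup : Finset (Fin K) → Fin K) (pickPoint : Finset (Fin n) → Fin n),
          (∀ s : Finset (Fin K), s.Nonempty → pickGroup s ∈ s) →
          (∀ s : Finset (Fin n), s.Nonempty → pickPoint s ∈ s) →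
          CerEval.IsCertified (CerEval.dataLaw P f A G) (CerEval.risk P f ℓ)
            (CerEval.cerEval P ℓ A m pickGroup pickPoint) n' ε δ := by
  refine ⟨2500, by norm_num, fun c₁ c₂ c₃ h1 h12 h3 => ?_⟩
  set x₀ := max (Real.exp 1) (Real.log c₂) with hx₀
  set y := Real.exp (-x₀) ^ (2 / 3 : ℝ) with hy
  have hy0 : 0 < y := Real.rpow_pos_of_pos (Real.exp_pos _) _
  have hc₂ : 0 < c₂ := by linarith
  -- `2 c₃ + 16384` comes from `card_evaluated_le`, one more unit absorbs the `+ 1` after the floor,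
  -- and `4 / y` serves the range where `ε` is bounded below.
  refine ⟨2 * c₃ + 16385 + 4 / y, by positivity, ?_⟩
  intro 𝒳 𝒴 _ _ P _ f _ ℓ hℓ hℓb K A hA hdisj hcov ε δ hε0 hε1 hδ0 hδ1 n m hn1 hn2 hm
  have hK : 1 ≤ K := by
    obtain ⟨z, k, -⟩ := hcov.exists
    exact (Nat.zero_le _).trans_lt k.2
  have hK1 : (1 : ℝ) ≤ K := by exact_mod_cast hK
  set q := Real.log ((K : ℝ) + 1) with hq
  set v : Fin K → ℝ := fun k => CerEval.condVar P f ℓ (A k) with hv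
  set H := ∑ k, max (v k) (ε ^ (2 / 3 : ℝ)) with hH
  have hq2 : 1 / 2 ≤ q := by
    have : Real.log 2 ≤ q := Real.log_le_log (by norm_num) (by linarith)
    linarith [Real.log_two_gt_d9]
  have hu0 : 0 < ε ^ (2 / 3 : ℝ) := Real.rpow_pos_of_pos hε0 _
  have hHε : ε ^ (2 / 3 : ℝ) ≤ H := by
    calc ε ^ (2 / 3 : ℝ) ≤ max (v ⟨0, hK⟩) (ε ^ (2 / 3 : ℝ)) := le_max_right _ _
      _ ≤ H := Finset.single_le_sum (f := fun k => max (v k) (ε ^ (2 / 3 : ℝ)))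
          (fun k _ => hu0.le.trans (le_max_right _ _)) (Finset.mem_univ _)
  have hqH : 0 < q * H := mul_pos (by linarith) (hu0.trans_le hHε)
  rcases le_or_gt x₀ (Real.log (1 / ε)) with hε | hε
  · set L := Real.log (1 / δ) + Real.log (Real.log (1 / ε)) with hL
    have hexp : Real.exp 1 ≤ Real.log (1 / ε) := (le_max_left _ _).trans hε
    have hL1 : 1 ≤ L := by
      have h4 : 0 < Real.log (1 / δ) := Real.log_pos ((one_lt_div hδ0).2 hδ1)
      have h5 : 1 ≤ Real.log (Real.log (1 / ε)) := by
        rw [← Real.log_exp 1]; exact Real.log_le_log (Real.exp_pos 1) (by rwa [Real.log_exp])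
      linarith
    have hn : 2500 * L ≤ n * ε ^ 2 := by
      calc 2500 * L ≤ c₁ * L := by gcongr
        _ = c₁ * (ε⁻¹ ^ 2 * L) * ε ^ 2 := by field_simp
        _ ≤ n * ε ^ 2 := by gcongr
    have hnu : 2500 ≤ n * ε ^ (2 / 3 : ℝ) := by
      have : ε ^ 2 ≤ ε ^ (2 / 3 : ℝ) := by
        rw [← Real.rpow_natCast]
        exact Real.rpow_le_rpow_of_exponent_ge hε0 hε1.le (by norm_num)
      calc (2500 : ℝ) ≤ n * ε ^ 2 := by linarith
        _ ≤ _ := by gcongr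
    have hn0 : (0 : ℝ) < n := by
      by_contra hneg
      have : (n : ℝ) * ε ^ (2 / 3 : ℝ) ≤ 0 := mul_nonpos_of_nonpos_of_nonneg (not_lt.1 hneg) hu0.le
      linarith
    have hone : 1 ≤ n * (q * ε ^ (2 / 3 : ℝ)) := by nlinarith
    have hone' : 1 ≤ n * (q * H) := hone.trans (by gcongr)
    refine ⟨⌊(2 * c₃ + 16384) * (n * (q * H))⌋₊ + 1, ?_, ?_⟩
    · rw [div_le_iff₀ hn0]
      have h5 := Nat.floor_le (a := (2 * c₃ + 16384) * (n * (q * H))) (by positivity)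
      have h6 : 0 ≤ 4 / y * (n * (q * H)) := by positivity
      push_cast
      nlinarith
    · intro G hG pickGroup pickPoint hpG hpP
      refine CerEval.isCertified_cerEval hℓ hℓb hK hA hdisj hcov hδ0 hδ1 G hpG hpP ?_
      rintro a Z rfl ha hvar
      have hsum : ∑ k, n * (q * max (v k) (ε ^ (2 / 3 : ℝ))) = n * (q * H) := by
        rw [← Finset.mul_sum, ← Finset.mul_sum]
      have h7 := CerEval.card_evaluated_le (v := v) (c := c₃) ha hε0 hε1 hδ0 hδ1 hn
        (fun t ht htn => CerEval.logFactor_le hK hδ0 hδ1 hc₂ hε0 hexp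
          ((le_max_right _ _).trans hε) ht htn hn2)
        (fun k => measureReal_nonneg)
        (by
          have := sum_measureReal_le_measureReal_univ (μ := P) (s := Finset.univ) (t := A)
            (fun k _ => hA k) fun j _ k _ hjk => hdisj hjk
          simpa using this)
        hvar (fun k => by
          have := hG k
          rw [le_div_iff₀ hn0] at this
          linarith)
        hone (by rw [hsum]; linarith) n
      rw [hsum] at h7
      exact Nat.lt_succ_of_le (Nat.le_floor h7)
  -- Here `ε > exp (-x₀)`, hence `q * H ≥ y / 2` and the bound is at least 2, which dominates `(n +
  -- 1) / n`. The case `n = 0` is possible, and then the quotient is 0 by convention.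
  · refine ⟨n + 1, ?_, ?_⟩
    · have hyH : y ≤ H := by
        refine le_trans (Real.rpow_le_rpow (Real.exp_pos _).le ?_ (by norm_num)) hHε
        rw [← Real.exp_log hε0]
        apply Real.exp_le_exp.2
        rw [one_div, Real.log_inv] at hε
        linarith
      have h5 : 2 ≤ (2 * c₃ + 16385 + 4 / y) * (q * H) := by
        calc (2 : ℝ) = 4 / y * (1 / 2 * y) := by field_simp; norm_num
          _ ≤ (2 * c₃ + 16385 + 4 / y) * (q * H) := by gcongr; linarith
      refine le_trans ?_ h5
      rcases Nat.eq_zero_or_pos n with rfl | hpos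
      · simp
      · have : (1 : ℝ) ≤ n := by exact_mod_cast hpos
        rw [div_le_iff₀ (by linarith)]
        push_cast
        linarith
    · intro G hG pickGroup pickPoint hpG hpP
      refine CerEval.isCertified_cerEval hℓ hℓb hK hA hdisj hcov hδ0 hδ1 G hpG hpP ?_
      intro a Z _ _ _
      exact Nat.lt_succ_of_le ((Finset.card_le_univ _).trans (by simp))
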